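/- **Setting.** For $\tau$ in the upper half-plane let $\wp(z)=\wp(z|\tau)$ be the Weierstrass function of the lattice $2\pi i(\mathbb Z+\tau\mathbb Z)$, with $\wp'^2=4\wp^3-g_2\wp-g_3$. Let $\omega\in\mathbb C\setminus\{0\}$ and put $$u=\frac{g_2(\tau)}{4(2\omega)^4},\qquad v=-\frac{g_3(\tau)}{4(2\omega)^6},\qquad A(x)=x^3-ux-(1-v).$$ Consider the $SU(3)$ Seiberg–Witten curve $y^2=A(x)^2-1=(x^3-ux+v)(x^3-ux+v-2)$ with differential $\lambda=xA'(x)\,dx/y$. It is parametrised near its three small branch points by $x=\wp(z)/(2\omega)^2$ and $y=\frac{i\,\wp'(z)}{\sqrt2\,(2\omega)^3}\sqrt{1-\tfrac12P}$, where $P=x^3-ux+v=\frac{\wp'(z)^2}{4(2\omega)^6}$ and the root is the principal one for $|P|<2$. An $\mathfrak A$-cycle (resp. $\mathfrak B$-cycle) is a $C^1$ path in the $z$-plane, avoiding the lattice, from some $z_0$ to $z_0+2\pi i$ (resp. $z_0+2\pi i\tau$). It is called short if $0<|P|<2$ along it. For such cycles put $$A_n=\frac1{2\pi i}\oint_{\mathfrak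 A}\wp^n\,dz,\quad B_n=\frac1{2\pi i}\oint_{\mathfrak B}\wp^n\,dz,\qquad a=\frac1{2\pi i}\oint_{\mathfrak A}\lambda,\quad a_D=\frac1{2\pi i}\oint_{\mathfrak B}\lambda,$$ where $A_n,B_n$ are defined for all $n\ge0$ and all such cycles, and $a,a_D$ for short ones, through their images on the curve. **Theorem.** 1. $g_2=E_4/12$ and $g_3=-E_6/216$; the points $(x,y)$ above lie on the curve. 2. For all $\mathfrak A$- and $\mathfrak B$-cycles, $A_0=1$, $B_0=\tau$, and for $J=A$ and $J=B$ $$(8n-4)J_n=(2n-3)g_2J_{n-2}+(2n-4)g_3J_{n-3}\qquad(n\ge2),$$ the last term being absent for $n=2$. Let $K_n$ be the solution of this recursion with $K_0=1$, $K_1=0$, and let $L_n$ be such that $n\mapsto L_{n-1}$ is the solution with $L_{-1}=0$, $L_0=1$. Then for $n\ge1$ $$A_n=K_n+\tfrac1{12}E_2L_{n-1},\qquad B_n=\tau A_n+\tfrac1{2\pi i}L_{n-1},$$ and, for all $n\ge0$, $K_n$ and $L_n$ are modular forms for $SL_2(\mathbb Z)$ of weight $2n$, given by weighted-homogeneous polynomials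 in $E_4,E_6$ with rational coefficients. 3. For each $\tau$ there are $\mathfrak A$- and $\mathfrak B$-cycles along which $\wp'\ne0$, and for every such cycle, if $|\omega|$ is large enough, then $|u|+|v|<1$ and the cycle is short. Whenever $|u|+|v|<1$ and the cycles are short, their images are closed paths on the curve off its branch points, and, with $$c_{k\ell m}=\frac{\Gamma(k+\ell+m+\frac12)}{2^{k+3\ell+3m}\,k!\,\ell!\,m!}\,\frac{(-1)^{\ell+m}g_2^\ell g_3^m}{(2\omega)^{6(k+\ell+m)+5}},$$ the following triple series converge absolutely: $$a=-i\sqrt{\tfrac2\pi}\sum_{k,\ell,m\ge0}c_{k\ell m}\Big(3A_{3k+\ell+3}-\tfrac{g_2}4A_{3k+\ell+1}\Big),\qquad a_D=-i\sqrt{\tfrac2\pi}\sum_{k,\ell,m\ge0}c_{k\ell m}\Big(3B_{3k+\ell+3}-\tfrac{g_2}4B_{3k+\ell+1}\Big),$$ $$a_D-\tau a=\frac{-2}{(2\pi)^{3/2}}\sum_{k,\ell,m\ge0}c_{k\ell m}\Big(3L_{3k+\ell+2}-\tfrac{g_2}4L_{3k+\ell}\Big).$$ 4. The set of $(\tau,2\omega)$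 with $\omega\ne0$ and $|u|+|v|<1$ is open. On it the last series converges absolutely, and its sum $\Phi(\tau,2\omega)$ is holomorphic. The set is invariant under $(\tau,2\omega)\mapsto\big(\frac{\alpha\tau+\beta}{\gamma\tau+\delta},(\gamma\tau+\delta)2\omega\big)$ for $\begin{pmatrix}\alpha&\beta\\\gamma&\delta\end{pmatrix}\in SL_2(\mathbb Z)$, and there $$\Phi\Big(\tfrac{\alpha\tau+\beta}{\gamma\tau+\delta},(\gamma\tau+\delta)2\omega\Big)=(\gamma\tau+\delta)^{-1}\Phi(\tau,2\omega),$$ i.e. $a_D-\tau a$ is modular of weight $-1$ when $\omega$ is assigned weight $1$. -/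

import Mathlib

open scoped MatrixGroups UpperHalfPlane

noncomputable section

namespace SU3

/-! ## The genus two curve `y² = A(x)² - 1`, `A(x) = x³ - u x - u₀`, `u₀ = 1 - v`, and its periods -/

/-- The polynomial `A(x) = x³ - u x - u₀` with `u₀ = 1 - v`. -/
def swA (u v x : ℂ) : ℂ := x ^ 3 - u * x - (1 - v)

/-- The curve `y² = A(x)² - 1 = (x³ - u x + v) (x³ - u x + v - 2)` (its affine part). -/
def swCurve (u v : ℂ) : Set (ℂ × ℂ) := {p | p.2 ^ 2 = swA u v p.1 ^ 2 - 1}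

/-- `t ↦ (x t, y t)`, `0 ≤ t ≤ 1`, is a closed path on the affine curve that does not meet the
branch points (the points with `y = 0`). -/
structure IsClosedPath (u v : ℂ) (x y : ℝ → ℂ) : Prop where
  continuousOn_x : ContinuousOn x (Set.Icc 0 1)
  continuousOn_y : ContinuousOn y (Set.Icc 0 1)
  mem : ∀ t ∈ Set.Icc (0 : ℝ) 1, (x t, y t) ∈ swCurve u v
  y_ne : ∀ t ∈ Set.Icc (0 : ℝ) 1, y t ≠ 0
  x_end : x 1 = x 0
  y_end : y 1 = y 0

/-- `(1 / 2πi) ∮ λ`, `λ = x A'(x) dx / y`, along the path `t ↦ (x t, y t)`, `0 ≤ t ≤ 1`. -/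
def swPeriod (u v : ℂ) (x y : ℝ → ℂ) : ℂ :=
  (2 * Real.pi * Complex.I)⁻¹ *
    ∫ t in (0 : ℝ)..1, x t * deriv (swA u v) (x t) * deriv x t / y t

/-! ## The elliptic parametrisation -/

/-- The periods `2πi` and `2πiτ`. -/
def periods (τ : ℍ) : PeriodPair where
  ω₁ := 2 * Real.pi * Complex.I
  ω₂ := 2 * Real.pi * Complex.I * τ
  indep := by
    rw [LinearIndependent.pair_iff]
    intro s t h
    have hc : (2 * Real.pi * Complex.I : ℂ) ≠ 0 := Complex.two_pi_I_ne_zero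
    have h1 : (2 * Real.pi * Complex.I : ℂ) * ((s : ℂ) + t * (τ : ℂ)) = 0 := by
      rw [← h]; simp only [Complex.real_smul]; ring
    have h2 : (s : ℂ) + t * (τ : ℂ) = 0 := (mul_eq_zero.mp h1).resolve_left hc
    have him := congrArg Complex.im h2
    have hre := congrArg Complex.re h2
    have ht : t = 0 := by
      have : t * τ.im = 0 := by simpa using him
      exact (mul_eq_zero.mp this).resolve_right τ.im_ne_zero
    subst ht
    exact ⟨by simpa using hre, rfl⟩

/-- The Weierstrass function `℘(z|τ)` of the lattice `2πi (ℤ + τ ℤ)`. -/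
def wp (τ : ℍ) (z : ℂ) : ℂ := (periods τ).weierstrassP z

/-- Its derivative `℘'(z|τ)`. -/
def wp' (τ : ℍ) (z : ℂ) : ℂ := (periods τ).derivWeierstrassP z

/-- The invariant `g₂(τ)` in `℘'² = 4 ℘³ - g₂ ℘ - g₃`. -/
def g₂ (τ : ℍ) : ℂ := (periods τ).g₂

/-- The invariant `g₃(τ)` in `℘'² = 4 ℘³ - g₂ ℘ - g₃`. -/
def g₃ (τ : ℍ) : ℂ := (periods τ).g₃

/-- The modulus `u`, from `4 (2ω)⁴ u = g₂(τ)`; here and below `w` stands for `2ω`. -/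
def modU (τ : ℍ) (w : ℂ) : ℂ := g₂ τ / (4 * w ^ 4)

/-- The modulus `v`, from `-4 (2ω)⁶ v = g₃(τ)`. -/
def modV (τ : ℍ) (w : ℂ) : ℂ := -g₃ τ / (4 * w ^ 6)

/-- The coordinate `x = ℘(z|τ) / (2ω)²`. -/
def coordX (τ : ℍ) (w z : ℂ) : ℂ := wp τ z / w ^ 2

/-- `x³ - u x + v` at `x = ℘(z|τ) / (2ω)²`, the factor of `y²` that vanishes at the three small
branch points. -/
def smallFactor (τ : ℍ) (w z : ℂ) : ℂ :=
  coordX τ w z ^ 3 - modU τ w * coordX τ w z + modV τ w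

/-- The coordinate `y`. Since `y² = P (P - 2)` with `P = x³ - u x + v = ℘'(z|τ)² / (4 (2ω)⁶)`, it is
`y = i ℘'(z|τ) / (√2 (2ω)³) * √(1 - P / 2)`; the principal root is holomorphic for `|P| < 2`. -/
def coordY (τ : ℍ) (w z : ℂ) : ℂ :=
  Complex.I * wp' τ z / (Real.sqrt 2 * w ^ 3) * (1 - smallFactor τ w z / 2) ^ (1 / 2 : ℂ)

/-! ## Cycles -/

/-- `γ`, restricted to `[0, 1]`, is a deformation of the segment `[0, c]` that avoids the poles of
`℘`: a continuously differentiable path from some `z₀` to `z₀ + c` in the complement of the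
lattice. -/
structure IsCycle (τ : ℍ) (c : ℂ) (γ : ℝ → ℂ) : Prop where
  contDiff : ContDiff ℝ 1 γ
  end_eq : γ 1 = γ 0 + c
  avoids : ∀ t ∈ Set.Icc (0 : ℝ) 1, γ t ∉ (periods τ).lattice

/-- A deformation of the short cycle `𝔄 = [0, 2πi]`. -/
def IsACycle (τ : ℍ) (γ : ℝ → ℂ) : Prop := IsCycle τ (2 * Real.pi * Complex.I) γ

/-- A deformation of the short cycle `𝔅 = [0, 2πiτ]`. -/
def IsBCycle (τ : ℍ) (γ : ℝ → ℂ) : Prop := IsCycle τ (2 * Real.pi * Complex.I * τ) γ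

/-- The cycle stays near the three small branch points, `|x³ - u x + v| < 2`, without meeting
them. -/
def IsShort (τ : ℍ) (w : ℂ) (γ : ℝ → ℂ) : Prop :=
  ∀ t ∈ Set.Icc (0 : ℝ) 1, 0 < ‖smallFactor τ w (γ t)‖ ∧ ‖smallFactor τ w (γ t)‖ < 2

/-- `(1 / 2πi) ∮ ℘(z)ⁿ dz` along `γ`: this is `Aₙ` for an `𝔄`-cycle, `Bₙ` for a `𝔅`-cycle. -/
def cycleIntegral (τ : ℍ) (γ : ℝ → ℂ) (n : ℕ) : ℂ :=
  (2 * Real.pi * Complex.I)⁻¹ * ∫ t in (0 : ℝ)..1, wp τ (γ t) ^ n * deriv γ t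

/-- The period `(1 / 2πi) ∮ λ` along the image of `γ` on the curve: this is `a` for an `𝔄`-cycle,
`a_D` for a `𝔅`-cycle. -/
def shortPeriod (τ : ℍ) (w : ℂ) (γ : ℝ → ℂ) : ℂ :=
  swPeriod (modU τ w) (modV τ w) (fun t => coordX τ w (γ t)) (fun t => coordY τ w (γ t))

/-! ## The recursion -/

/-- `(8n - 4) Jₙ = (2n - 3) g₂ Jₙ₋₂ + (2n - 4) g₃ Jₙ₋₃` for all `n ≥ 2`; the last term is absent for
`n = 2`, where its coefficient vanishes. -/
def Recursion (g h : ℂ) (J : ℕ → ℂ) : Prop :=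
  12 * J 2 = g * J 0 ∧
    ∀ n : ℕ, 3 ≤ n →
      (8 * n - 4) * J n = (2 * n - 3) * g * J (n - 2) + (2 * n - 4) * h * J (n - 3)

/-- The solution of the recursion, with `g = g₂`, `h = g₃`, for given values `J₀`, `J₁`. -/
def recSol (g h J₀ J₁ : ℂ) : ℕ → ℂ
  | 0 => J₀
  | 1 => J₁
  | 2 => g * J₀ / 12
  | n + 3 =>
    ((2 * (n + 3) - 3) * g * recSol g h J₀ J₁ (n + 1) +
      (2 * (n + 3) - 4) * h * recSol g h J₀ J₁ n) / (8 * (n + 3) - 4)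

/-- `Kₙ`: the solution of the recursion with `K₀ = 1`, `K₁ = 0`. -/
def K (n : ℕ) (τ : ℍ) : ℂ := recSol (g₂ τ) (g₃ τ) 1 0 n

/-- `Lₙ`: here `n ↦ Lₙ₋₁` is the solution of the recursion with `L₋₁ = 0`, `L₀ = 1`. -/
def L (n : ℕ) (τ : ℍ) : ℂ := recSol (g₂ τ) (g₃ τ) 0 1 (n + 1)

/-! ## The triple series -/

/-- `Γ(k+ℓ+m+1/2) / (2^(k+3ℓ+3m) k! ℓ! m!) * (-1)^(ℓ+m) g₂^ℓ g₃^m / (2ω)^(6(k+ℓ+m)+5)`. -/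
def coeff (τ : ℍ) (w : ℂ) (k l m : ℕ) : ℂ :=
  (Real.Gamma (k + l + m + 1 / 2) : ℂ) /
      (2 ^ (k + 3 * l + 3 * m) * (k.factorial : ℂ) * (l.factorial : ℂ) * (m.factorial : ℂ)) *
    ((-1) ^ (l + m) * g₂ τ ^ l * g₃ τ ^ m / w ^ (6 * (k + l + m) + 5))

/-- The general term of the series for `a` (with `J = A`) and for `a_D` (with `J = B`). -/
def periodTerm (τ : ℍ) (w : ℂ) (J : ℕ → ℂ) (p : ℕ × ℕ × ℕ) : ℂ :=
  -Complex.I * (Real.sqrt (2 / Real.pi) : ℂ) * coeff τ w p.1 p.2.1 p.2.2 *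
    (3 * J (3 * p.1 + p.2.1 + 3) - g₂ τ / 4 * J (3 * p.1 + p.2.1 + 1))

/-- The general term of the series for `a_D - τ a`. -/
def modularTerm (τ : ℍ) (w : ℂ) (p : ℕ × ℕ × ℕ) : ℂ :=
  ((-2 / (2 * Real.pi) ^ (3 / 2 : ℝ) : ℝ) : ℂ) * coeff τ w p.1 p.2.1 p.2.2 *
    (3 * L (3 * p.1 + p.2.1 + 2) τ - g₂ τ / 4 * L (3 * p.1 + p.2.1) τ)

/-- The sum of the series for `a_D - τ a`. -/
def modularSum (τ : ℍ) (w : ℂ) : ℂ := ∑' p : ℕ × ℕ × ℕ, modularTerm τ w p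

/-- The domain `ω ≠ 0`, `|u| + |v| < 1` of pairs `(τ, 2ω)`. -/
def InDomain (τ : ℍ) (w : ℂ) : Prop := w ≠ 0 ∧ ‖modU τ w‖ + ‖modV τ w‖ < 1

/-- The same domain as a subset of `ℂ × ℂ`. -/
def domain : Set (ℂ × ℂ) := {p | ∃ h : 0 < p.1.im, InDomain ⟨p.1, h⟩ p.2}

end SU3

end

namespace SU3

/-! ## The invariants as Eisenstein series -/

/-! The exact differential `d(℘ⁿ ℘')` integrates to zero along a closed cycle; after `℘'² = 4℘³ -
g₂℘ - g₃` this is the recursion (`IsCycle.recursion_cycleIntegral`), so all cycle integrals are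
determined by the zeroth, which is the period, and the first. For the first, the lattice series of
`℘` is integrated termwise. Each term contributes a difference of reciprocals, which telescopes to
zero along rows parallel to the cycle (`hasSum_row`), and there remains the sum of `1/l²` over the
lattice, taken along those rows first. For an `𝔄`-cycle this order gives `G2`; for a `𝔅`-cycle it
gives the transform of `G2` under `S`, whose anomaly is Legendre's relation. Hence `A₁ = E₂/12` and
`B₁ - τ A₁ = 1/(2πi)`. Since `B₀ = τ A₀`, the sequence `Bₙ - τ Aₙ` is `1/(2πi)` times the solution
with initial values `0, 1`: the quasi-modular `E₂` drops out.

With `P = ℘'²/(4(2ω)⁶)` the form `λ` becomes a polynomial in `℘` times `(1 - P/2)^(-1/2) dz`. On a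
short cycle the binomial series in `P/2` may be integrated termwise, and the trinomial expansion of
`P^N` turns it into the triple series (`IsCycle.hasSum_periodTerm`). Absolute convergence of the
triple series is a separate matter, governed by `|u| + |v| < 1`: in units `2ω = 1` the solutions of
the recursion are bounded (`norm_recSol_le`), and the coefficients are dominated by the trinomial
expansion of `((1 + |u| + |v|)/2)^N` (`norm_normTerm_le`).

In the same units the series for `a_D - τ a` is a constant times `(2ω)⁻¹` times a function of `(u,
v)` alone (`modularSum_eq`). As `u` and `v` are invariant under `SL₂(ℤ)`, weight `-1` is immediate;
holomorphy follows from the domination, which is locally uniform in `(u, v)`. -/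

lemma latticeEquivProd_symm_periods (τ : ℍ) (p : ℤ × ℤ) :
    (((periods τ).latticeEquivProd.symm p : (periods τ).lattice) : ℂ) =
      2 * Real.pi * Complex.I * (p.2 * τ + p.1) := by
  rw [PeriodPair.latticeEquiv_symm_apply]
  simp only [periods]
  ring

/-- The lattice sum over `2πi(ℤ + τℤ)` in terms of the normalised Eisenstein series. -/
lemma G_periods (τ : ℍ) {k : ℕ} (hk : 3 ≤ k) :
    (periods τ).G k = ((2 * Real.pi * Complex.I) ^ k)⁻¹ *
      (2 * riemannZeta k * ModularForm.E hk τ) := by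
  have hE : ModularForm.E hk τ =
      (1 / 2 : ℂ) • EisensteinSeries.eisensteinSeriesSIF (N := 1) 0 k τ := rfl
  rw [hE, EisensteinSeries.eisensteinSeriesSIF_apply, smul_eq_mul,
    show (2 : ℂ) * riemannZeta k * (1 / 2 * eisensteinSeries (N := 1) 0 k τ) =
      riemannZeta k * eisensteinSeries (N := 1) 0 k τ by ring,
    ← tsum_eisSummand_eq_riemannZeta_mul_eisensteinSeries hk, ← tsum_mul_left, PeriodPair.G,
    -- The lattice coordinates list the coefficient of `2πi` first, while `eisSummand` lists the
    -- coefficient of `τ` first; hence the swap.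
    ← (periods τ).latticeEquivProd.symm.toEquiv.tsum_eq,
    ← ((finTwoArrowEquiv ℤ).trans (Equiv.prodComm ℤ ℤ)).tsum_eq]
  refine tsum_congr fun v => ?_
  change ((((periods τ).latticeEquivProd.symm (v 1, v 0) : (periods τ).lattice) : ℂ) ^ k)⁻¹ = _
  rw [latticeEquivProd_symm_periods, mul_pow, mul_inv, EisensteinSeries.eisSummand, zpow_neg,
    zpow_natCast]

lemma riemannZeta_six : riemannZeta 6 = Real.pi ^ 6 / 945 := by
  have h := riemannZeta_two_mul_nat (k := 3) (by norm_num)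
  have hb : bernoulli 6 = 1 / 42 := by
    rw [bernoulli_eq_bernoulli'_of_ne_one (by norm_num)]
    have h5 : bernoulli' 5 = 0 := by
      rw [bernoulli'_def]; norm_num [Finset.sum_range_succ, Nat.choose]
    rw [bernoulli'_def]
    norm_num [Finset.sum_range_succ, Nat.choose, h5]
  norm_num [hb, Nat.factorial] at h
  rw [h]; ring

lemma g₂_eq (τ : ℍ) : g₂ τ = ModularForm.E₄ τ / 12 := by
  have h : riemannZeta (4 : ℕ) = Real.pi ^ 4 / 90 := by exact_mod_cast riemannZeta_four
  have hp : (Real.pi : ℂ) ≠ 0 := by exact_mod_cast Real.pi_ne_zero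
  rw [g₂, PeriodPair.g₂, G_periods τ (by norm_num : 3 ≤ 4), h, mul_pow, mul_pow, Complex.I_pow_four]
  field_simp
  ring

lemma g₃_eq (τ : ℍ) : g₃ τ = -ModularForm.E₆ τ / 216 := by
  have h : riemannZeta (6 : ℕ) = Real.pi ^ 6 / 945 := by exact_mod_cast riemannZeta_six
  have hp : (Real.pi : ℂ) ≠ 0 := by exact_mod_cast Real.pi_ne_zero
  have hI : Complex.I ^ 6 = -1 := by
    rw [show 6 = 4 + 2 by rfl, pow_add, Complex.I_pow_four, Complex.I_sq, one_mul]
  rw [g₃, PeriodPair.g₃, G_periods τ (by norm_num : 3 ≤ 6), h, mul_pow, mul_pow, hI]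
  field_simp
  ring

/-! ## The recursion -/

section Recursion

variable {g h : ℂ}

lemma Recursion.eq_recSol {J : ℕ → ℂ} (hJ : Recursion g h J) :
    ∀ n, J n = recSol g h (J 0) (J 1) n
  | 0 => by rw [recSol]
  | 1 => by rw [recSol]
  | 2 => by rw [recSol, ← hJ.1]; ring
  | n + 3 => by
    have h3 := hJ.2 (n + 3) (by omega)
    have hne : (8 * ((n : ℂ) + 3) - 4) ≠ 0 := by
      have : ((8 * n + 20 : ℕ) : ℂ) ≠ 0 := Nat.cast_ne_zero.mpr (by omega)
      intro h0; apply this; push_cast; linear_combination h0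
    rw [recSol, ← hJ.eq_recSol (n + 1), ← hJ.eq_recSol n, eq_div_iff hne]
    simp only [Nat.add_sub_cancel, show n + 3 - 2 = n + 1 by omega] at h3
    push_cast at h3
    linear_combination h3

lemma recSol_eq_combination (g h a b : ℂ) :
    ∀ n, recSol g h a b n = a * recSol g h 1 0 n + b * recSol g h 0 1 n
  | 0 => by simp only [recSol]; ring
  | 1 => by simp only [recSol]; ring
  | 2 => by simp only [recSol]; ring
  | n + 3 => by
    rw [recSol, recSol, recSol, recSol_eq_combination g h a b (n + 1),
      recSol_eq_combination g h a b n]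
    ring

/-- The recursion is homogeneous for the weights `4` and `6` of its coefficients. -/
lemma recSol_scale (s g h a b : ℂ) :
    ∀ n, recSol (s ^ 4 * g) (s ^ 6 * h) a (s ^ 2 * b) n = s ^ (2 * n) * recSol g h a b n
  | 0 => by simp [recSol]
  | 1 => by simp [recSol]
  | 2 => by simp only [recSol]; ring
  | n + 3 => by
    rw [recSol, recSol, recSol_scale s g h a b (n + 1), recSol_scale s g h a b n]
    ring

/-- At index `n + 3` the coefficients have moduli `(8n+12)‖u‖` and `(8n+8)‖v‖` against the divisor
`8n+20`, so each new value is at most `‖u‖ + ‖v‖ ≤ 1` times the bound on the earlier ones. This is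
what singles out the domain of convergence. -/
lemma norm_recSol_le {u v : ℂ} (huv : ‖u‖ + ‖v‖ ≤ 1) (a b : ℂ) :
    ∀ n, ‖recSol (4 * u) (-4 * v) a b n‖ ≤ max ‖a‖ ‖b‖
  | 0 => by rw [recSol]; exact le_max_left _ _
  | 1 => by rw [recSol]; exact le_max_right _ _
  | 2 => by
    have hu : ‖u‖ ≤ 1 := by linarith [norm_nonneg v]
    rw [recSol, norm_div, norm_mul, norm_mul]
    have : ‖u‖ * ‖a‖ ≤ 1 * ‖a‖ := by gcongr
    have := le_max_left ‖a‖ ‖b‖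
    have := norm_nonneg a
    norm_num
    constructor
    linarith
  | n + 3 => by
    have h1 := norm_recSol_le huv a b (n + 1)
    have h0 := norm_recSol_le huv a b n
    set M := max ‖a‖ ‖b‖
    have hM : 0 ≤ M := (norm_nonneg a).trans (le_max_left _ _)
    have hd : (8 * ((n : ℂ) + 3) - 4) = ((8 * n + 20 : ℕ) : ℂ) := by push_cast; ring
    have hp : (0 : ℝ) < 8 * n + 20 := by positivity
    rw [recSol, hd, norm_div, Complex.norm_natCast, div_le_iff₀ (by exact_mod_cast hp)]
    have e1 : (2 * ((n : ℂ) + 3) - 3) * (4 * u) * recSol (4 * u) (-4 * v) a b (n + 1) =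
      ((8 * n + 12 : ℕ) : ℂ) * (u * recSol (4 * u) (-4 * v) a b (n + 1)) := by push_cast; ring
    have e2 : (2 * ((n : ℂ) + 3) - 4) * (-4 * v) * recSol (4 * u) (-4 * v) a b n =
      -(((8 * n + 8 : ℕ) : ℂ) * (v * recSol (4 * u) (-4 * v) a b n)) := by push_cast; ring
    rw [e1, e2]
    refine (norm_add_le _ _).trans ?_
    rw [norm_neg]
    simp only [norm_mul, Complex.norm_natCast]
    have k1 : ‖u‖ * ‖recSol (4 * u) (-4 * v) a b (n + 1)‖ ≤ ‖u‖ * M := by gcongr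
    have k2 : ‖v‖ * ‖recSol (4 * u) (-4 * v) a b n‖ ≤ ‖v‖ * M := by gcongr
    calc _ ≤ ((8 * n + 20 : ℕ) : ℝ) * (‖u‖ * M) + ((8 * n + 20 : ℕ) : ℝ) * (‖v‖ * M) := by
          gcongr <;> omega
      _ = ((8 * n + 20 : ℕ) : ℝ) * ((‖u‖ + ‖v‖) * M) := by ring
      _ ≤ ((8 * n + 20 : ℕ) : ℝ) * (1 * M) := by gcongr
      _ = _ := by ring

end Recursion

/-! ## `Kₙ` and `Lₙ` are modular forms -/

/-- `F` is a modular form of level one and weight `k`. -/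
def IsModular (k : ℤ) (F : ℍ → ℂ) : Prop := ∃ f : ModularForm 𝒮ℒ k, ∀ τ, f τ = F τ

lemma IsModular.add {k : ℤ} {F G : ℍ → ℂ} (hF : IsModular k F) (hG : IsModular k G) :
    IsModular k (fun τ => F τ + G τ) := by
  obtain ⟨f, hf⟩ := hF
  obtain ⟨g, hg⟩ := hG
  exact ⟨f + g, fun τ => by rw [add_apply, hf, hg]⟩

lemma IsModular.const_mul {k : ℤ} {F : ℍ → ℂ} (c : ℂ) (hF : IsModular k F) :
    IsModular k (fun τ => c * F τ) := by
  obtain ⟨f, hf⟩ := hF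
  exact ⟨c • f, fun τ => by rw [smul_apply, hf, smul_eq_mul]⟩

lemma IsModular.mul {k₁ k₂ k : ℤ} {F G : ℍ → ℂ} (hF : IsModular k₁ F) (hG : IsModular k₂ G)
    (hk : k₁ + k₂ = k) : IsModular k (fun τ => F τ * G τ) := by
  subst hk
  obtain ⟨f, hf⟩ := hF
  obtain ⟨g, hg⟩ := hG
  exact ⟨f.mul g, fun τ => by rw [ModularForm.coe_mul, Pi.mul_apply, hf, hg]⟩

lemma isModular_const (c : ℂ) : IsModular 0 (fun _ => c) :=
  ⟨c • (1 : ModularForm 𝒮ℒ 0), fun τ => by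
    rw [smul_apply, ModularForm.one_coe_eq_one]; simp⟩

lemma isModular_zero (k : ℤ) : IsModular k (fun _ => 0) := ⟨0, fun τ => zero_apply τ⟩

lemma isModular_g₂ : IsModular 4 g₂ := by
  have := IsModular.const_mul (k := 4) (F := ModularForm.E₄) (1 / 12) ⟨_, fun _ => rfl⟩
  convert this using 2 with τ
  rw [g₂_eq]; ring

lemma isModular_g₃ : IsModular 6 g₃ := by
  have := IsModular.const_mul (k := 6) (F := ModularForm.E₆) (-1 / 216) ⟨_, fun _ => rfl⟩
  convert this using 2 with τ
  rw [g₃_eq]; ring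

/-- The starting weight `j` is left free because `L` is the solution that starts at index `-1`,
hence in weight `-2`; its initial value `0` there is modular of every weight. -/
lemma isModular_recSol {j : ℤ} {a b : ℂ} (ha : IsModular j (fun _ => a))
    (hb : IsModular (j + 2) (fun _ => b)) :
    ∀ n : ℕ, IsModular (j + 2 * n) (fun τ => recSol (g₂ τ) (g₃ τ) a b n)
  | 0 => by simpa [recSol] using ha
  | 1 => by simpa [recSol] using hb
  | 2 => by
    have := (isModular_g₂.mul ha (k := j + (2 : ℕ) * 2) (by push_cast; ring)).const_mul (1 / 12)
    convert this using 2 with τ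
    · norm_num
    · simp only [recSol]; ring
  | n + 3 => by
    have h1 := isModular_g₂.mul (isModular_recSol ha hb (n + 1)) (k := j + 2 * (n + 3 : ℕ))
      (by push_cast; ring)
    have h0 := isModular_g₃.mul (isModular_recSol ha hb n) (k := j + 2 * (n + 3 : ℕ))
      (by push_cast; ring)
    have := (h1.const_mul ((2 * (n + 3) - 3) / (8 * (n + 3) - 4))).add
      (h0.const_mul ((2 * (n + 3) - 4) / (8 * (n + 3) - 4)))
    convert this using 2 with τ
    rw [recSol]; ring

lemma isModular_K (n : ℕ) : IsModular (2 * n) (K n) := by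
  simpa using! isModular_recSol (isModular_const 1) (isModular_zero (0 + 2)) n

lemma isModular_L (n : ℕ) : IsModular (2 * n) (L n) := by
  have := isModular_recSol (j := -2) (isModular_zero (-2)) (b := 1) (by
    simpa using isModular_const 1) (n + 1)
  convert this using 1
  · push_cast; ring
  · rfl

/-- `F` is a weighted homogeneous polynomial of weight `k` in `E₄` and `E₆` with rational
coefficients. -/
def IsEisensteinPolynomial (k : ℕ) (F : ℍ → ℂ) : Prop :=
  ∃ P : MvPolynomial (Fin 2) ℚ, P.IsWeightedHomogeneous ![4, 6] k ∧
    ∀ τ : ℍ, F τ = P.aeval ![ModularForm.E₄ τ, ModularForm.E₆ τ]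

lemma IsEisensteinPolynomial.add {k : ℕ} {F G : ℍ → ℂ} (hF : IsEisensteinPolynomial k F)
    (hG : IsEisensteinPolynomial k G) : IsEisensteinPolynomial k (fun τ => F τ + G τ) := by
  obtain ⟨P, hP, hP'⟩ := hF
  obtain ⟨Q, hQ, hQ'⟩ := hG
  exact ⟨P + Q, hP.add hQ, fun τ => by simp only [map_add, hP', hQ']⟩

lemma IsEisensteinPolynomial.mul {k₁ k₂ k : ℕ} {F G : ℍ → ℂ} (hF : IsEisensteinPolynomial k₁ F)
    (hG : IsEisensteinPolynomial k₂ G) (hk : k₁ + k₂ = k) :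
    IsEisensteinPolynomial k (fun τ => F τ * G τ) := by
  subst hk
  obtain ⟨P, hP, hP'⟩ := hF
  obtain ⟨Q, hQ, hQ'⟩ := hG
  exact ⟨P * Q, hP.mul hQ, fun τ => by simp only [map_mul, hP', hQ']⟩

lemma isEisensteinPolynomial_const (q : ℚ) : IsEisensteinPolynomial 0 (fun _ => (q : ℂ)) :=
  ⟨MvPolynomial.C q, MvPolynomial.isWeightedHomogeneous_C _ q, fun τ => by
    rw [MvPolynomial.aeval_C]; simp⟩

lemma isEisensteinPolynomial_zero (k : ℕ) : IsEisensteinPolynomial k (fun _ => 0) :=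
  ⟨0, MvPolynomial.isWeightedHomogeneous_zero _ _ _, fun τ => by simp⟩

lemma isEisensteinPolynomial_g₂ : IsEisensteinPolynomial 4 g₂ := by
  have h : IsEisensteinPolynomial 4 (fun τ => ModularForm.E₄ τ) :=
    ⟨MvPolynomial.X 0, MvPolynomial.isWeightedHomogeneous_X _ _ _, fun τ => by simp⟩
  convert (isEisensteinPolynomial_const (1 / 12)).mul h (zero_add 4) using 2 with τ
  rw [g₂_eq]; push_cast; ring

lemma isEisensteinPolynomial_g₃ : IsEisensteinPolynomial 6 g₃ := by
  have h : IsEisensteinPolynomial 6 (fun τ => ModularForm.E₆ τ) :=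
    ⟨MvPolynomial.X 1, MvPolynomial.isWeightedHomogeneous_X _ _ _, fun τ => by simp⟩
  convert (isEisensteinPolynomial_const (-1 / 216)).mul h (zero_add 6) using 2 with τ
  rw [g₃_eq]; push_cast; ring

/-- Weights of polynomials are natural numbers, so the weight `-2` start of `L` is not available.
Only the inductive step is shared, and `K` and `L` each get their own three base cases. -/
lemma IsEisensteinPolynomial.recSol_add_three {k : ℕ} {a b : ℂ} {n : ℕ}
    (h1 : IsEisensteinPolynomial (k + 2) (fun τ => recSol (g₂ τ) (g₃ τ) a b (n + 1)))
    (h0 : IsEisensteinPolynomial k (fun τ => recSol (g₂ τ) (g₃ τ) a b n)) :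
    IsEisensteinPolynomial (k + 6) (fun τ => recSol (g₂ τ) (g₃ τ) a b (n + 3)) := by
  have h1 := (isEisensteinPolynomial_const ((2 * (n + 3) - 3) / (8 * (n + 3) - 4))).mul
    (isEisensteinPolynomial_g₂.mul h1 (k := k + 6) (by ring)) (zero_add _)
  have h0 := (isEisensteinPolynomial_const ((2 * (n + 3) - 4) / (8 * (n + 3) - 4))).mul
    (isEisensteinPolynomial_g₃.mul h0 (k := k + 6) (by ring)) (zero_add _)
  convert h1.add h0 using 2 with τ
  rw [recSol]; push_cast; ring

lemma isEisensteinPolynomial_K : ∀ n : ℕ, IsEisensteinPolynomial (2 * n) (K n)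
  | 0 => by simpa [K, recSol] using! isEisensteinPolynomial_const 1
  | 1 => by simpa [K, recSol] using! isEisensteinPolynomial_zero 2
  | 2 => by
    convert (isEisensteinPolynomial_const (1 / 12)).mul isEisensteinPolynomial_g₂ (zero_add _)
      using 2 with τ
    simp only [K, recSol]; push_cast; ring
  | n + 3 => IsEisensteinPolynomial.recSol_add_three (k := 2 * n)
    (isEisensteinPolynomial_K (n + 1)) (isEisensteinPolynomial_K n)

lemma isEisensteinPolynomial_L : ∀ n : ℕ, IsEisensteinPolynomial (2 * n) (L n)
  | 0 => by simpa [L, recSol] using! isEisensteinPolynomial_const 1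
  | 1 => by
    convert isEisensteinPolynomial_zero 2 using 2 with τ
    simp [L, recSol]
  | 2 => by
    convert (isEisensteinPolynomial_const (3 / 20)).mul isEisensteinPolynomial_g₂ (zero_add _)
      using 2 with τ
    simp only [L, recSol]; push_cast; ring
  | n + 3 => IsEisensteinPolynomial.recSol_add_three (k := 2 * n) (n := n + 1)
    (isEisensteinPolynomial_L (n + 1)) (isEisensteinPolynomial_L n)

end SU3

/-! ## Zeros of `℘'` -/

namespace PeriodPair

open Filter Topology

instance (L : PeriodPair) : Countable L.lattice := L.latticeEquivProd.injective.countable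

lemma countable_lattice (L : PeriodPair) : (L.lattice : Set ℂ).Countable :=
  Set.countable_coe_iff.mp (inferInstanceAs (Countable L.lattice))

lemma isPreconnected_compl_lattice (L : PeriodPair) : IsPreconnected (L.lattice : Set ℂ)ᶜ :=
  (Set.Countable.isConnected_compl_of_one_lt_rank (by simp [Complex.rank_real_complex])
    L.countable_lattice).isPreconnected

lemma isOpen_compl_lattice (L : PeriodPair) : IsOpen (L.lattice : Set ℂ)ᶜ :=
  L.isClosed_lattice.isOpen_compl

/-- The pole at `0` forces this: `℘'` minus its term `-2/z³` is analytic at `0`. If `℘'` vanished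
off the lattice, `z³` times that difference would be constantly `2` near `0`, yet it tends to `0`.
-/
lemma exists_derivWeierstrassP_ne_zero (L : PeriodPair) :
    ∃ z ∉ L.lattice, L.derivWeierstrassP z ≠ 0 := by
  by_contra! h
  have hlim : Tendsto (fun z : ℂ => z ^ 3 * L.derivWeierstrassPExcept 0 z) (𝓝[≠] 0) (𝓝 0) := by
    have hc : ContinuousAt (fun z : ℂ => z ^ 3 * L.derivWeierstrassPExcept 0 z) 0 :=
      (continuousAt_id.pow 3).mul (L.analyticAt_derivWeierstrassPExcept 0).continuousAt
    simpa using hc.tendsto.mono_left nhdsWithin_le_nhds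
  have heq : (fun _ : ℂ => (2 : ℂ)) =ᶠ[𝓝[≠] 0]
      fun z : ℂ => z ^ 3 * L.derivWeierstrassPExcept 0 z := by
    filter_upwards [self_mem_nhdsWithin, mem_nhdsWithin_of_mem_nhds
      (L.compl_lattice_sdiff_singleton_mem_nhds 0)] with z hz0 hz
    have hz0 : z ≠ 0 := hz0
    have hzL : z ∉ L.lattice := fun hm => hz ⟨hm, hz0⟩
    have := L.derivWeierstrassPExcept_def 0 z
    rw [ZeroMemClass.coe_zero, h z hzL, sub_zero] at this
    rw [this]
    field_simp
    ring
  exact two_ne_zero (tendsto_nhds_unique (tendsto_const_nhds.congr' heq) hlim)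

/-- Identity theorem on the complement of the lattice, which is connected because the lattice is
countable. -/
lemma eventually_derivWeierstrassP_ne_zero (L : PeriodPair) {z : ℂ} (hz : z ∉ L.lattice) :
    ∀ᶠ w in 𝓝[≠] z, L.derivWeierstrassP w ≠ 0 := by
  by_contra h
  have hfreq : ∃ᶠ w in 𝓝[≠] z, L.derivWeierstrassP w = 0 := by
    simpa [Filter.not_eventually] using h
  obtain ⟨y, hy, hy0⟩ := L.exists_derivWeierstrassP_ne_zero
  exact hy0 (L.analyticOnNhd_derivWeierstrassP.eqOn_zero_of_preconnected_of_frequently_eq_zero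
    L.isPreconnected_compl_lattice hz hfreq hy)

/-- Off the lattice the zeros are isolated, and a discrete subset of the plane is countable. The
lattice points must be added because the total function `℘'` takes the value `0` there. -/
lemma countable_setOf_derivWeierstrassP_eq_zero (L : PeriodPair) :
    {z | L.derivWeierstrassP z = 0}.Countable := by
  have hsub : {z | L.derivWeierstrassP z = 0} ⊆
      (L.lattice : Set ℂ) ∪ {z | z ∉ L.lattice ∧ L.derivWeierstrassP z = 0} := fun z hz => by
    by_cases h : z ∈ L.lattice
    · exact Or.inl h
    · exact Or.inr ⟨h, hz⟩
  refine (L.countable_lattice.union ?_).mono hsub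
  have : DiscreteTopology {z | z ∉ L.lattice ∧ L.derivWeierstrassP z = 0} := by
    rw [discreteTopology_subtype_iff]
    intro z hz
    rw [← Filter.empty_mem_iff_bot, Filter.mem_inf_principal]
    filter_upwards [L.eventually_derivWeierstrassP_ne_zero hz.1] with w hw hw'
    exact hw hw'.2
  exact Set.countable_coe_iff.mp (TopologicalSpace.separableSpace_iff_countable.mp inferInstance)

lemma hasDerivAt_weierstrassP (L : PeriodPair) {z : ℂ} (hz : z ∉ L.lattice) :
    HasDerivAt L.weierstrassP (L.derivWeierstrassP z) z := by
  rw [← L.deriv_weierstrassP]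
  exact ((L.analyticOnNhd_weierstrassP z hz).differentiableAt).hasDerivAt

/-- `℘'' = 6 ℘² - g₂ / 2`. -/
lemma hasDerivAt_derivWeierstrassP (L : PeriodPair) {z : ℂ} (hz : z ∉ L.lattice) :
    HasDerivAt L.derivWeierstrassP (6 * L.weierstrassP z ^ 2 - L.g₂ / 2) z := by
  -- Differentiating the cubic relation gives `2℘'℘'' = (12℘² - g₂)℘'`. Dividing by `℘'` works away
  -- from its isolated zeros, and continuity extends the result to them.
  have hd : ∀ w ∉ L.lattice, HasDerivAt L.derivWeierstrassP (deriv L.derivWeierstrassP w) w :=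
    fun w hw => (L.analyticOnNhd_derivWeierstrassP w hw).differentiableAt.hasDerivAt
  have heq : ∀ w ∉ L.lattice, L.derivWeierstrassP w ≠ 0 →
      deriv L.derivWeierstrassP w = 6 * L.weierstrassP w ^ 2 - L.g₂ / 2 := by
    intro w hw hw0
    have h1 := (hd w hw).pow 2
    have h2 := ((((L.hasDerivAt_weierstrassP hw).pow 3).const_mul 4).sub
      ((L.hasDerivAt_weierstrassP hw).const_mul L.g₂)).sub_const L.g₃
    have h3 := (h1.congr_of_eventuallyEq (by
      filter_upwards [L.isOpen_compl_lattice.mem_nhds hw] with y hy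
      exact (L.derivWeierstrassP_sq y hy).symm)).unique h2
    apply mul_left_cancel₀ hw0
    norm_num at h3
    linear_combination h3 / 2
  have hc1 : ContinuousAt (deriv L.derivWeierstrassP) z :=
    (L.analyticOnNhd_derivWeierstrassP z hz).deriv.continuousAt
  have hc2 : ContinuousAt (fun w => 6 * L.weierstrassP w ^ 2 - L.g₂ / 2) z :=
    (((L.analyticOnNhd_weierstrassP z hz).continuousAt.pow 2).const_mul 6).sub_const _
  have := tendsto_nhds_unique (hc1.tendsto.mono_left (nhdsWithin_le_nhds (s := {z}ᶜ)))
    ((hc2.tendsto.mono_left (nhdsWithin_le_nhds (s := {z}ᶜ))).congr' (by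
      filter_upwards [L.eventually_derivWeierstrassP_ne_zero hz,
        mem_nhdsWithin_of_mem_nhds (L.isOpen_compl_lattice.mem_nhds hz)] with w hw hw'
      exact (heq w hw' hw).symm))
  rw [← this]
  exact hd z hz

end PeriodPair

namespace SU3

open Filter Topology

/-! ## Integrals along cycles -/

lemma hasDerivAt_wp {τ : ℍ} {z : ℂ} (hz : z ∉ (periods τ).lattice) :
    HasDerivAt (wp τ) (wp' τ z) z := (periods τ).hasDerivAt_weierstrassP hz

lemma hasDerivAt_wp' {τ : ℍ} {z : ℂ} (hz : z ∉ (periods τ).lattice) :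
    HasDerivAt (wp' τ) (6 * wp τ z ^ 2 - g₂ τ / 2) z :=
  (periods τ).hasDerivAt_derivWeierstrassP hz

lemma wp'_sq {τ : ℍ} {z : ℂ} (hz : z ∉ (periods τ).lattice) :
    wp' τ z ^ 2 = 4 * wp τ z ^ 3 - g₂ τ * wp τ z - g₃ τ :=
  (periods τ).derivWeierstrassP_sq z hz

namespace IsCycle

variable {τ : ℍ} {c : ℂ} {γ : ℝ → ℂ}

lemma hasDerivAt (hγ : IsCycle τ c γ) (t : ℝ) : HasDerivAt γ (deriv γ t) t :=
  (hγ.contDiff.differentiable one_ne_zero t).hasDerivAt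

lemma continuous_deriv (hγ : IsCycle τ c γ) : Continuous (deriv γ) :=
  hγ.contDiff.continuous_deriv le_rfl

lemma continuousOn_comp (hγ : IsCycle τ c γ) {f : ℂ → ℂ}
    (hf : ∀ z ∉ (periods τ).lattice, ContinuousAt f z) :
    ContinuousOn (fun t => f (γ t)) (Set.Icc 0 1) := fun t ht =>
  ((hf _ (hγ.avoids t ht)).comp (f := γ) hγ.contDiff.continuous.continuousAt).continuousWithinAt

lemma continuousOn_wp (hγ : IsCycle τ c γ) : ContinuousOn (fun t => wp τ (γ t)) (Set.Icc 0 1) :=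
  hγ.continuousOn_comp fun _ hz => (hasDerivAt_wp hz).continuousAt

lemma continuousOn_wp' (hγ : IsCycle τ c γ) : ContinuousOn (fun t => wp' τ (γ t)) (Set.Icc 0 1) :=
  hγ.continuousOn_comp fun _ hz => (hasDerivAt_wp' hz).continuousAt

/-- The fundamental theorem of calculus along a cycle. -/
lemma integral_eq_sub (hγ : IsCycle τ c γ) {F f : ℂ → ℂ}
    (hF : ∀ z ∉ (periods τ).lattice, HasDerivAt F (f z) z)
    (hf : ∀ z ∉ (periods τ).lattice, ContinuousAt f z) :
    ∫ t in (0 : ℝ)..1, f (γ t) * deriv γ t = F (γ 0 + c) - F (γ 0) := by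
  rw [← hγ.end_eq]
  refine intervalIntegral.integral_eq_sub_of_hasDerivAt (f := fun t => F (γ t)) ?_ ?_
  · intro t ht
    rw [Set.uIcc_of_le zero_le_one] at ht
    exact (hF _ (hγ.avoids t ht)).comp t (hγ.hasDerivAt t)
  · refine ContinuousOn.intervalIntegrable ?_
    rw [Set.uIcc_of_le zero_le_one]
    exact (hγ.continuousOn_comp hf).mul hγ.continuous_deriv.continuousOn

lemma intervalIntegrable_wp_pow (hγ : IsCycle τ c γ) (n : ℕ) :
    IntervalIntegrable (fun t => wp τ (γ t) ^ n * deriv γ t) MeasureTheory.volume 0 1 := by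
  refine ContinuousOn.intervalIntegrable ?_
  rw [Set.uIcc_of_le zero_le_one]
  exact (hγ.continuousOn_wp.pow n).mul hγ.continuous_deriv.continuousOn

lemma cycleIntegral_zero (hγ : IsCycle τ c γ) :
    cycleIntegral τ γ 0 = (2 * Real.pi * Complex.I)⁻¹ * c := by
  have := hγ.integral_eq_sub (F := id) (f := fun _ => 1) (fun z _ => hasDerivAt_id z)
    fun z _ => continuousAt_const
  simp only [cycleIntegral, pow_zero]
  rw [this]
  simp

/-- The integrand is the derivative of `℘ⁿ ℘'`, which takes equal values at the two ends since `c`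
is a period. -/
lemma cycleIntegral_recursion_aux (hγ : IsCycle τ c γ) (hc : c ∈ (periods τ).lattice) (n : ℕ) :
    ∫ t in (0 : ℝ)..1, (n * wp τ (γ t) ^ (n - 1) * wp' τ (γ t) * wp' τ (γ t) +
      wp τ (γ t) ^ n * (6 * wp τ (γ t) ^ 2 - g₂ τ / 2)) * deriv γ t = 0 := by
  rw [hγ.integral_eq_sub (F := fun z => wp τ z ^ n * wp' τ z)
    (f := fun z => n * wp τ z ^ (n - 1) * wp' τ z * wp' τ z +
      wp τ z ^ n * (6 * wp τ z ^ 2 - g₂ τ / 2))]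
  · have h1 : wp τ (γ 0 + c) = wp τ (γ 0) := (periods τ).weierstrassP_add_coe (γ 0) ⟨c, hc⟩
    have h2 : wp' τ (γ 0 + c) = wp' τ (γ 0) := (periods τ).derivWeierstrassP_add_coe (γ 0) ⟨c, hc⟩
    rw [h1, h2, sub_self]
  · exact fun z hz => ((hasDerivAt_wp hz).pow n).mul (hasDerivAt_wp' hz)
  · intro z hz
    have h1 := (hasDerivAt_wp hz).continuousAt
    have h2 := (hasDerivAt_wp' hz).continuousAt
    fun_prop

lemma recursion_cycleIntegral (hγ : IsCycle τ c γ) (hc : c ∈ (periods τ).lattice) :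
    Recursion (g₂ τ) (g₃ τ) (cycleIntegral τ γ) := by
  have hint := hγ.intervalIntegrable_wp_pow
  constructor
  · have h := hγ.cycleIntegral_recursion_aux hc 0
    have : ∀ t, (((0 : ℕ) : ℂ) * wp τ (γ t) ^ (0 - 1) * wp' τ (γ t) * wp' τ (γ t) +
      wp τ (γ t) ^ 0 * (6 * wp τ (γ t) ^ 2 - g₂ τ / 2)) * deriv γ t =
      6 * (wp τ (γ t) ^ 2 * deriv γ t) - g₂ τ / 2 * (wp τ (γ t) ^ 0 * deriv γ t) := fun t => by
        push_cast; ring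
    simp only [this] at h
    rw [intervalIntegral.integral_sub ((hint 2).const_mul _) ((hint 0).const_mul _),
      intervalIntegral.integral_const_mul, intervalIntegral.integral_const_mul] at h
    simp only [cycleIntegral]
    linear_combination 2 * (2 * Real.pi * Complex.I)⁻¹ * h
  · intro m hm
    obtain ⟨n, rfl⟩ := Nat.exists_eq_add_of_le' hm
    -- The exponent is `m - 2 = n + 1`. Eliminating `℘'²` leaves `4(n+1) + 6 = 4n + 10` in front of
    -- `℘ⁿ⁺³`, which is half of `8m - 4`.
    have h := hγ.cycleIntegral_recursion_aux hc (n + 1)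
    have key : Set.EqOn (fun t => (((n + 1 : ℕ) : ℂ) * wp τ (γ t) ^ (n + 1 - 1) * wp' τ (γ t) *
        wp' τ (γ t) + wp τ (γ t) ^ (n + 1) * (6 * wp τ (γ t) ^ 2 - g₂ τ / 2)) * deriv γ t)
        (fun t => (4 * n + 10) * (wp τ (γ t) ^ (n + 3) * deriv γ t) -
          (n + 3 / 2) * g₂ τ * (wp τ (γ t) ^ (n + 1) * deriv γ t) -
          (n + 1) * g₃ τ * (wp τ (γ t) ^ n * deriv γ t)) (Set.uIcc 0 1) := by
      intro t ht
      rw [Set.uIcc_of_le zero_le_one] at ht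
      have := wp'_sq (hγ.avoids t ht)
      simp only [Nat.add_sub_cancel]
      push_cast
      linear_combination (n + 1) * wp τ (γ t) ^ n * deriv γ t * this
    rw [intervalIntegral.integral_congr key,
      intervalIntegral.integral_sub (((hint _).const_mul _).sub ((hint _).const_mul _))
        ((hint n).const_mul _),
      intervalIntegral.integral_sub ((hint _).const_mul _) ((hint _).const_mul _)] at h
    simp only [intervalIntegral.integral_const_mul] at h
    simp only [cycleIntegral, Nat.add_sub_cancel, show n + 3 - 2 = n + 1 by omega]
    push_cast
    linear_combination 2 * (2 * Real.pi * Complex.I)⁻¹ * h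

end IsCycle

lemma two_pi_I_mem_lattice (τ : ℍ) : 2 * Real.pi * Complex.I ∈ (periods τ).lattice :=
  (periods τ).ω₁_mem_lattice

lemma two_pi_I_mul_mem_lattice (τ : ℍ) : 2 * Real.pi * Complex.I * τ ∈ (periods τ).lattice :=
  (periods τ).ω₂_mem_lattice

/-! ## Existence of cycles off the branch points -/

/-- Lines parallel to `c` are indexed by the real number `Im(s/c)`. Only countably many of them meet
`S`, so some line misses it. -/
lemma exists_forall_add_mul_notMem {S : Set ℂ} (hS : S.Countable) {c : ℂ} (hc : c ≠ 0) :
    ∃ z₀ : ℂ, ∀ t : ℝ, z₀ + t * c ∉ S := by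
  obtain ⟨r, hr⟩ : ((fun s : ℂ => (s / c).im) '' S)ᶜ.Nonempty := by
    rw [Set.nonempty_compl]
    intro h
    exact Set.not_countable_univ (h ▸ hS.image _)
  refine ⟨r * Complex.I * c, fun t ht => hr ⟨_, ht, ?_⟩⟩
  have : (r * Complex.I * c + t * c) / c = t + r * Complex.I := by field_simp; ring
  simp [this]

lemma exists_isCycle (τ : ℍ) {c : ℂ} (hc : c ≠ 0) :
    ∃ γ : ℝ → ℂ, IsCycle τ c γ ∧ ∀ t, wp' τ (γ t) ≠ 0 := by
  obtain ⟨z₀, hz⟩ := exists_forall_add_mul_notMem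
    (periods τ).countable_setOf_derivWeierstrassP_eq_zero hc
  refine ⟨fun t => z₀ + t * c, ⟨?_, by simp, fun t _ ht => hz t ?_⟩, hz⟩
  · exact contDiff_const.add (Complex.ofRealCLM.contDiff.mul contDiff_const)
  -- Avoiding the zeros of `℘'` already avoids the lattice, where `℘'` has the default value `0`.
  · exact (periods τ).derivWeierstrassP_coe ⟨_, ht⟩

end SU3

/-! ### The integral of `℘` along a cycle and Legendre's relation. -/

open Filter Topology SummationFilter in
lemma TendstoUniformlyOn.mul_right_of_bounded {α ι : Type*} {F : ι → α → ℂ} {f g : α → ℂ}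
    {p : Filter ι} {s : Set α} (h : TendstoUniformlyOn F f p s) {C : ℝ} (hg : ∀ x ∈ s, ‖g x‖ ≤ C) :
    TendstoUniformlyOn (fun i x => F i x * g x) (fun x => f x * g x) p s := by
  rw [Metric.tendstoUniformlyOn_iff] at h ⊢
  intro ε hε
  have hC : (0 : ℝ) < |C| + 1 := by positivity
  filter_upwards [h (ε / (|C| + 1)) (by positivity)] with i hi x hx
  rw [dist_eq_norm, ← sub_mul, norm_mul]
  have h1 := hi x hx
  rw [dist_eq_norm, lt_div_iff₀ hC] at h1
  refine lt_of_le_of_lt ?_ h1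
  gcongr
  linarith [hg x hx, le_abs_self C]

namespace SU3

open Filter Topology SummationFilter

lemma tendsto_inv_sub_natCast_mul (a : ℂ) {b : ℂ} (hb : b ≠ 0) :
    Tendsto (fun n : ℕ => (a - n * b)⁻¹) atTop (𝓝 0) := by
  refine tendsto_inv₀_cobounded.comp ?_
  rw [← tendsto_norm_atTop_iff_cobounded]
  have h : Tendsto (fun n : ℕ => (n : ℝ) * ‖b‖ - ‖a‖) atTop atTop :=
    tendsto_atTop_add_const_right _ _
      (tendsto_natCast_atTop_atTop.atTop_mul_const (norm_pos_iff.mpr hb))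
  refine tendsto_atTop_mono (fun n => ?_) h
  have := norm_sub_norm_le ((n : ℂ) * b) a
  rw [norm_mul, Complex.norm_natCast, norm_sub_rev] at this
  exact this

/-- Telescoping along one direction of a lattice. -/
lemma hasSum_row {z d b : ℂ} (hb : b ≠ 0) (hs : Summable fun n : ℤ => ((n * b + d) ^ 2)⁻¹)
    (h : Summable fun n : ℤ =>
      (z - (n * b + d))⁻¹ - (z + b - (n * b + d))⁻¹ - b * ((n * b + d) ^ 2)⁻¹) :
    HasSum (fun n : ℤ =>
      (z - (n * b + d))⁻¹ - (z + b - (n * b + d))⁻¹ - b * ((n * b + d) ^ 2)⁻¹)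
      (-b * ∑' n : ℤ, ((n * b + d) ^ 2)⁻¹) := by
  have h1 : Summable fun n : ℤ => (z - (n * b + d))⁻¹ - (z + b - (n * b + d))⁻¹ := by
    simpa using h.add (hs.mul_left b)
  have h2 : ∑' n : ℤ, ((z - (n * b + d))⁻¹ - (z + b - (n * b + d))⁻¹) = 0 := by
    -- Summability being known, the value may be computed over the windows `[-N, N)`, whose sums
    -- telescope to two boundary terms tending to `0`.
    rw [← tsum_eq_of_summable_unconditional (L := symmetricIco ℤ) h1]
    refine HasSum.tsum_eq ?_
    rw [hasSum_symmetricIco_int_iff]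
    have hlim : Tendsto (fun N : ℕ => -((z + b - d + N * b)⁻¹ - (z + b - d - N * b)⁻¹))
        atTop (𝓝 0) := by
      have e1 := tendsto_inv_sub_natCast_mul (z + b - d) (neg_ne_zero.mpr hb)
      have e2 := tendsto_inv_sub_natCast_mul (z + b - d) hb
      simpa using (e1.sub e2).neg
    refine hlim.congr fun N => ?_
    have := Finset.sum_Ico_int_sub N (fun n : ℤ => (z + b - d - n * b)⁻¹)
    push_cast at this
    rw [show z + b - d + N * b = z + b - d - -N * b by ring, ← this, ← Finset.sum_neg_distrib]
    refine Finset.sum_congr rfl fun n _ => ?_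
    rw [neg_sub]
    congr 2 <;> ring
  have := h.hasSum
  rwa [Summable.tsum_sub h1 (hs.mul_left b), h2, tsum_mul_left, zero_sub, ← neg_mul] at this

namespace IsCycle

variable {τ : ℍ} {c : ℂ} {γ : ℝ → ℂ}

/-- Termwise integration of `℘` along a cycle. -/
lemma hasSum_integral_wp (hγ : IsCycle τ c γ) :
    HasSum (fun l : (periods τ).lattice =>
      (γ 0 - l)⁻¹ - (γ 0 + c - l)⁻¹ - c * ((l : ℂ) ^ 2)⁻¹)
      (∫ t in (0 : ℝ)..1, wp τ (γ t) * deriv γ t) := by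
  set Λ := (periods τ).lattice
  have hterm : ∀ l : Λ, ∀ t ∈ Set.Icc (0 : ℝ) 1,
      ContinuousWithinAt (fun t => 1 / (γ t - l) ^ 2 - 1 / (l : ℂ) ^ 2) (Set.Icc 0 1) t := by
    intro l t ht
    have hne : γ t - l ≠ 0 := fun h => hγ.avoids t ht (by rw [sub_eq_zero.mp h]; exact l.2)
    have hc := hγ.contDiff.continuous.continuousWithinAt (s := Set.Icc 0 1) (x := t)
    exact (continuousWithinAt_const.div ((hc.sub continuousWithinAt_const).pow 2)
      (pow_ne_zero 2 hne)).sub continuousWithinAt_const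
  have hγc : IsCompact (γ '' Set.Icc 0 1) := isCompact_Icc.image hγ.contDiff.continuous
  have hunif : TendstoUniformlyOn
      (fun (s : Finset Λ) t => ∑ l ∈ s, (1 / (γ t - l) ^ 2 - 1 / (l : ℂ) ^ 2))
      (fun t => wp τ (γ t)) atTop (Set.Icc 0 1) := by
    have h := hasSumLocallyUniformly_iff_tendstoLocallyUniformly.mp
      (periods τ).hasSumLocallyUniformly_weierstrassP
    have h' := (tendstoLocallyUniformlyOn_iff_tendstoUniformlyOn_of_compact hγc).mp
      (h.tendstoLocallyUniformlyOn)
    exact (h'.comp γ).mono (Set.subset_preimage_image γ _)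
  obtain ⟨C, hC⟩ := isCompact_Icc.exists_bound_of_continuousOn
    (hγ.continuous_deriv.continuousOn (s := Set.Icc 0 1))
  have hunif' := hunif.mul_right_of_bounded hC
  rw [← Set.uIcc_of_le (zero_le_one (α := ℝ))] at hunif'
  have hlim := hunif'.tendsto_intervalIntegral_of_continuousOn (μ := MeasureTheory.volume) (by
    refine Eventually.of_forall fun s => ?_
    rw [Set.uIcc_of_le zero_le_one]
    exact (continuousOn_finsetSum s fun l _ t ht => hterm l t ht).mul
      hγ.continuous_deriv.continuousOn)
  refine hlim.congr fun s => ?_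
  simp only [Finset.sum_mul]
  rw [intervalIntegral.integral_finsetSum]
  · refine Finset.sum_congr rfl fun l _ => ?_
    have hne : ∀ z ∉ Λ, z - (l : ℂ) ≠ 0 := fun z hz h =>
      hz (by rw [sub_eq_zero.mp h]; exact l.2)
    -- For `l = 0` the convention `1/0 = 0` makes the correction vanish, so the primitive also
    -- covers the term `1/z²`.
    rw [hγ.integral_eq_sub (F := fun z => -(z - l)⁻¹ - z * (1 / (l : ℂ) ^ 2))
      (f := fun z => 1 / (z - l) ^ 2 - 1 / (l : ℂ) ^ 2)]
    · rw [one_div]; ring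
    · intro z hz
      have h1 := (((hasDerivAt_id z).sub_const (l : ℂ)).inv (hne z hz)).neg
      refine (h1.sub ((hasDerivAt_id z).mul_const (1 / (l : ℂ) ^ 2))).congr_deriv ?_
      simp [neg_div]
    · intro z hz
      have := hne z hz
      exact (continuousAt_const.div ((continuousAt_id.sub continuousAt_const).pow 2)
        (pow_ne_zero 2 this)).sub continuousAt_const
  · intro l _
    refine ContinuousOn.intervalIntegrable ?_
    rw [Set.uIcc_of_le zero_le_one]
    exact ContinuousOn.mul (fun t ht => hterm l t ht) hγ.continuous_deriv.continuousOn

lemma hasSum_integral_wp_prod (hγ : IsCycle τ c γ) :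
    HasSum (fun p : ℤ × ℤ =>
      (γ 0 - 2 * Real.pi * Complex.I * (p.2 * τ + p.1))⁻¹ -
        (γ 0 + c - 2 * Real.pi * Complex.I * (p.2 * τ + p.1))⁻¹ -
        c * ((2 * Real.pi * Complex.I * (p.2 * τ + p.1)) ^ 2)⁻¹)
      (∫ t in (0 : ℝ)..1, wp τ (γ t) * deriv γ t) := by
  have h := (periods τ).latticeEquivProd.symm.toEquiv.hasSum_iff.mpr hγ.hasSum_integral_wp
  refine h.congr_fun fun p => ?_
  simp only [Function.comp_apply, LinearEquiv.coe_toEquiv, latticeEquivProd_symm_periods]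

end IsCycle

lemma G2_eq_E2 (τ : ℍ) : EisensteinSeries.G2 τ = Real.pi ^ 2 / 3 * EisensteinSeries.E2 τ := by
  have hp : (Real.pi : ℂ) ≠ 0 := by exact_mod_cast Real.pi_ne_zero
  rw [EisensteinSeries.E2, Pi.smul_apply, smul_eq_mul, riemannZeta_two]
  field_simp
  ring

/-- `℘` integrates to the first quasi-period along an `𝔄`-cycle. -/
lemma IsACycle.integral_wp {τ : ℍ} {γ : ℝ → ℂ} (hγ : IsACycle τ γ) :
    ∫ t in (0 : ℝ)..1, wp τ (γ t) * deriv γ t =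
      -(2 * Real.pi * Complex.I)⁻¹ * EisensteinSeries.G2 τ := by
  have h2 : (2 * Real.pi * Complex.I : ℂ) ≠ 0 := Complex.two_pi_I_ne_zero
  -- Rows must run in the direction `2πi` of the cycle, so the coefficient `m` of `τ` becomes the
  -- outer index.
  have h := (Equiv.prodComm ℤ ℤ).hasSum_iff.mpr (IsCycle.hasSum_integral_wp_prod hγ)
  simp only [Function.comp_def, Equiv.prodComm_apply, Prod.fst_swap, Prod.snd_swap] at h
  have hrow : ∀ m : ℤ, HasSum (fun n : ℤ =>
      (γ 0 - 2 * Real.pi * Complex.I * (m * τ + n))⁻¹ -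
        (γ 0 + 2 * Real.pi * Complex.I - 2 * Real.pi * Complex.I * (m * τ + n))⁻¹ -
        2 * Real.pi * Complex.I * ((2 * Real.pi * Complex.I * (m * τ + n)) ^ 2)⁻¹)
      (-(2 * Real.pi * Complex.I)⁻¹ * EisensteinSeries.e2Summand m τ) := by
    intro m
    have e : ∀ n : ℤ, 2 * Real.pi * Complex.I * (m * (τ : ℂ) + n) =
        n * (2 * Real.pi * Complex.I) + m * (2 * Real.pi * Complex.I * τ) := fun n => by ring
    have e' : ∀ n : ℤ, ((n * (2 * Real.pi * Complex.I) + m * (2 * Real.pi * Complex.I * τ)) ^ 2)⁻¹ =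
        ((2 * Real.pi * Complex.I) ^ 2)⁻¹ * EisensteinSeries.eisSummand 2 ![m, n] τ := fun n => by
      rw [← e, mul_pow, mul_inv]
      simp [EisensteinSeries.eisSummand, zpow_ofNat]
    have hs := h.summable.prod_factor m
    simp only [e] at hs ⊢
    have := hasSum_row h2 (by
      simp only [e']; exact (EisensteinSeries.e2Summand_summable m τ).mul_left _) hs
    convert this using 1
    simp only [e', tsum_mul_left]
    rw [EisensteinSeries.e2Summand]
    field_simp
  have h3 := h.prod_fiberwise hrow
  -- The row sums inherit unconditional summability from the double series, so they agree with the
  -- symmetric limit that defines `G2`.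
  have hs : Summable fun m : ℤ => EisensteinSeries.e2Summand m τ :=
    (summable_mul_left_iff (neg_ne_zero.mpr (inv_ne_zero h2))).mp h3.summable
  rw [← h3.tsum_eq, tsum_mul_left, EisensteinSeries.G2,
    tsum_eq_of_summable_unconditional (L := symmetricIcc ℤ) hs]

/-- Together with `IsACycle.integral_wp` this is Legendre's relation. -/
lemma IsBCycle.integral_wp {τ : ℍ} {γ : ℝ → ℂ} (hγ : IsBCycle τ γ) :
    ∫ t in (0 : ℝ)..1, wp τ (γ t) * deriv γ t =
      -τ * (2 * Real.pi * Complex.I)⁻¹ * EisensteinSeries.G2 τ + 1 := by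
  have h2 : (2 * Real.pi * Complex.I : ℂ) ≠ 0 := Complex.two_pi_I_ne_zero
  have hτ : (τ : ℂ) ≠ 0 := UpperHalfPlane.ne_zero τ
  have h := IsCycle.hasSum_integral_wp_prod hγ
  have hsum : ∀ n : ℤ, Summable fun m : ℤ => 1 / ((m : ℂ) * τ + n) ^ 2 := fun n => by
    simpa using! EisensteinSeries.linear_left_summable hτ n (k := 2) le_rfl
  have hrow : ∀ n : ℤ, HasSum (fun m : ℤ =>
      (γ 0 - 2 * Real.pi * Complex.I * (m * τ + n))⁻¹ -
        (γ 0 + 2 * Real.pi * Complex.I * τ - 2 * Real.pi * Complex.I * (m * τ + n))⁻¹ -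
        2 * Real.pi * Complex.I * τ * ((2 * Real.pi * Complex.I * (m * τ + n)) ^ 2)⁻¹)
      (-τ * (2 * Real.pi * Complex.I)⁻¹ * ∑' m : ℤ, 1 / ((m : ℂ) * τ + n) ^ 2) := by
    intro n
    have e : ∀ m : ℤ, 2 * Real.pi * Complex.I * (m * (τ : ℂ) + n) =
        m * (2 * Real.pi * Complex.I * τ) + n * (2 * Real.pi * Complex.I) := fun m => by ring
    have e' : ∀ m : ℤ, ((m * (2 * Real.pi * Complex.I * τ) + n * (2 * Real.pi * Complex.I)) ^ 2)⁻¹ =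
        ((2 * Real.pi * Complex.I) ^ 2)⁻¹ * (1 / ((m : ℂ) * τ + n) ^ 2) := fun m => by
      rw [← e, mul_pow, mul_inv, one_div]
    have hs := h.summable.prod_factor n
    simp only [e] at hs ⊢
    have := hasSum_row (mul_ne_zero h2 hτ) (by simp only [e']; exact (hsum n).mul_left _) hs
    convert this using 1
    simp only [e', tsum_mul_left]
    field_simp
  have h3 := h.prod_fiberwise hrow
  have hs : Summable fun n : ℤ => ∑' m : ℤ, 1 / ((m : ℂ) * τ + n) ^ 2 :=
    (summable_mul_left_iff (mul_ne_zero (neg_ne_zero.mpr hτ) (inv_ne_zero h2))).mp h3.summable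
  -- Here the rows run in the direction `τ`. This opposite order of summation is the action of `S`
  -- on `G2`, and its non-modular term produces the `1`.
  rw [← h3.tsum_eq, tsum_mul_left, ← tsum_eq_of_summable_unconditional (L := symmetricIco ℤ) hs,
    EisensteinSeries.tsum_symmetricIco_tsum_eq_S_act, EisensteinSeries.G2_S_transform τ]
  field_simp
  ring

lemma IsACycle.cycleIntegral_one {τ : ℍ} {γ : ℝ → ℂ} (hγ : IsACycle τ γ) :
    cycleIntegral τ γ 1 = EisensteinSeries.E2 τ / 12 := by
  have hp : (Real.pi : ℂ) ≠ 0 := by exact_mod_cast Real.pi_ne_zero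
  simp only [cycleIntegral, pow_one]
  rw [hγ.integral_wp, G2_eq_E2]
  field_simp
  rw [Complex.I_sq]
  ring

lemma IsBCycle.cycleIntegral_one {τ : ℍ} {γ : ℝ → ℂ} (hγ : IsBCycle τ γ) :
    cycleIntegral τ γ 1 =
      τ * (EisensteinSeries.E2 τ / 12) + 1 / (2 * Real.pi * Complex.I) := by
  have hp : (Real.pi : ℂ) ≠ 0 := by exact_mod_cast Real.pi_ne_zero
  simp only [cycleIntegral, pow_one]
  rw [hγ.integral_wp, G2_eq_E2]
  field_simp
  linear_combination (-12 * Real.pi * τ * EisensteinSeries.E2 τ) * Complex.I_sq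

lemma IsACycle.cycleIntegral_zero {τ : ℍ} {γ : ℝ → ℂ} (hγ : IsACycle τ γ) :
    cycleIntegral τ γ 0 = 1 := by
  rw [IsCycle.cycleIntegral_zero hγ, inv_mul_cancel₀ Complex.two_pi_I_ne_zero]

lemma IsBCycle.cycleIntegral_zero {τ : ℍ} {γ : ℝ → ℂ} (hγ : IsBCycle τ γ) :
    cycleIntegral τ γ 0 = τ := by
  rw [IsCycle.cycleIntegral_zero hγ, inv_mul_cancel_left₀ Complex.two_pi_I_ne_zero]

lemma IsACycle.recursion {τ : ℍ} {γ : ℝ → ℂ} (hγ : IsACycle τ γ) :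
    Recursion (g₂ τ) (g₃ τ) (cycleIntegral τ γ) :=
  IsCycle.recursion_cycleIntegral hγ (two_pi_I_mem_lattice τ)

lemma IsBCycle.recursion {τ : ℍ} {γ : ℝ → ℂ} (hγ : IsBCycle τ γ) :
    Recursion (g₂ τ) (g₃ τ) (cycleIntegral τ γ) :=
  IsCycle.recursion_cycleIntegral hγ (two_pi_I_mul_mem_lattice τ)

lemma IsACycle.cycleIntegral_succ {τ : ℍ} {γ : ℝ → ℂ} (hγ : IsACycle τ γ) (n : ℕ) :
    cycleIntegral τ γ (n + 1) = K (n + 1) τ + EisensteinSeries.E2 τ / 12 * L n τ := by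
  rw [hγ.recursion.eq_recSol, recSol_eq_combination, hγ.cycleIntegral_zero, hγ.cycleIntegral_one,
    one_mul, K, L]

/-- Both sides solve the same recursion; `B` and `τ A` agree at index `0` and differ by `1/(2πi)` at
index `1`. -/
lemma IsBCycle.cycleIntegral_succ {τ : ℍ} {γA γB : ℝ → ℂ} (hγ : IsBCycle τ γB)
    (hγA : IsACycle τ γA) (n : ℕ) :
    cycleIntegral τ γB (n + 1) =
      τ * cycleIntegral τ γA (n + 1) + 1 / (2 * Real.pi * Complex.I) * L n τ := by
  rw [hγA.cycleIntegral_succ, hγ.recursion.eq_recSol, recSol_eq_combination,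
    hγ.cycleIntegral_zero, hγ.cycleIntegral_one, K, L]
  ring

end SU3

namespace SU3

open Filter Topology Finset

/-! ## Triple series -/

/-- Triples of natural numbers, grouped by their sum. -/
def sigmaTripleEquiv :
    (Σ N : ℕ, Σ p : antidiagonal N, antidiagonal p.1.2) ≃ ℕ × ℕ × ℕ where
  toFun x := (x.2.1.1.1, x.2.2.1.1, x.2.2.1.2)
  invFun p := ⟨p.1 + (p.2.1 + p.2.2), ⟨(p.1, p.2.1 + p.2.2), mem_antidiagonal.mpr rfl⟩,
    ⟨(p.2.1, p.2.2), mem_antidiagonal.mpr rfl⟩⟩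
  left_inv := by
    rintro ⟨N, ⟨⟨k, s⟩, hp⟩, ⟨⟨l, m⟩, hq⟩⟩
    obtain rfl := mem_antidiagonal.mp hq
    obtain rfl := mem_antidiagonal.mp hp
    rfl
  right_inv _ := rfl

/-- The sum of `f` over the triples with sum `N`. -/
def groupSum {M : Type*} [AddCommMonoid M] (f : ℕ × ℕ × ℕ → M) (N : ℕ) : M :=
  ∑ p ∈ antidiagonal N, ∑ q ∈ antidiagonal p.2, f (p.1, q.1, q.2)

lemma sum_sigmaTripleEquiv {M : Type*} [AddCommMonoid M] (f : ℕ × ℕ × ℕ → M) (N : ℕ) :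
    ∑ x : (Σ p : antidiagonal N, antidiagonal p.1.2), f (sigmaTripleEquiv ⟨N, x⟩) =
      groupSum f N := by
  rw [Fintype.sum_sigma, groupSum, ← Finset.sum_coe_sort (antidiagonal N)]
  refine Finset.sum_congr rfl fun p _ => ?_
  rw [← Finset.sum_coe_sort (antidiagonal p.1.2)]
  rfl

/-- The period is computed as a single series in `N = k + ℓ + m`; given summability of the triple
family, this identifies its sum. -/
lemma hasSum_of_hasSum_groupSum {f : ℕ × ℕ × ℕ → ℂ} (hf : Summable f) {S : ℂ}
    (h : HasSum (groupSum f) S) : HasSum f S := by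
  have h1 := sigmaTripleEquiv.hasSum_iff.mpr hf.hasSum
  have h2 := h1.sigma (g := groupSum f) fun N => by
    rw [← sum_sigmaTripleEquiv]
    exact hasSum_fintype _
  rw [h.unique h2]
  exact hf.hasSum

lemma summable_of_summable_groupSum {f : ℕ × ℕ × ℕ → ℝ} (hf : ∀ p, 0 ≤ f p)
    (h : Summable (groupSum f)) : Summable f := by
  rw [← sigmaTripleEquiv.summable_iff, summable_sigma_of_nonneg (f := f ∘ sigmaTripleEquiv) fun x => hf _]
  refine ⟨fun N => (hasSum_fintype _).summable, h.congr fun N => ?_⟩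
  rw [tsum_fintype, ← sum_sigmaTripleEquiv]
  rfl

/-- The trinomial theorem. -/
lemma groupSum_trinomial {F : Type*} [Field F] [CharZero F] (x y z : F) (N : ℕ) :
    groupSum (fun p : ℕ × ℕ × ℕ => ((p.1 + p.2.1 + p.2.2).factorial : F) /
      (p.1.factorial * p.2.1.factorial * p.2.2.factorial) *
        (x ^ p.1 * y ^ p.2.1 * z ^ p.2.2)) N = (x + y + z) ^ N := by
  rw [add_assoc, (Commute.all x (y + z)).add_pow', groupSum]
  refine Finset.sum_congr rfl fun p hp => ?_
  rw [(Commute.all y z).add_pow', Finset.mul_sum, Finset.smul_sum]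
  refine Finset.sum_congr rfl fun q hq => ?_
  obtain ⟨k, s⟩ := p
  obtain ⟨l, m⟩ := q
  obtain rfl := mem_antidiagonal.mp hq
  obtain rfl := mem_antidiagonal.mp hp
  simp only [nsmul_eq_mul]
  rw [Nat.cast_add_choose, Nat.cast_add_choose, add_assoc]
  have h (n : ℕ) : ((n.factorial : ℕ) : F) ≠ 0 := Nat.cast_ne_zero.mpr n.factorial_ne_zero
  have := h (l + m)
  field_simp

/-- Grouped by `k + ℓ + m`, the nonnegative terms form the geometric series of ratio `x + y + z`. -/
lemma summable_trinomial {x y z : ℝ} (hx : 0 ≤ x) (hy : 0 ≤ y) (hz : 0 ≤ z)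
    (h : x + y + z < 1) :
    Summable fun p : ℕ × ℕ × ℕ => ((p.1 + p.2.1 + p.2.2).factorial : ℝ) /
      (p.1.factorial * p.2.1.factorial * p.2.2.factorial) *
        (x ^ p.1 * y ^ p.2.1 * z ^ p.2.2) := by
  refine summable_of_summable_groupSum (fun p => by positivity) ?_
  simp only [funext fun N => groupSum_trinomial x y z N]
  exact summable_geometric_of_lt_one (by positivity) h

/-! ## The coefficients `Γ(N + 1/2)` -/

lemma Gamma_add_half_nonneg (N : ℕ) : 0 ≤ Real.Gamma (N + 1 / 2) :=
  (Real.Gamma_pos_of_pos (by positivity)).le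

lemma Gamma_succ_add_half (N : ℕ) :
    Real.Gamma ((N + 1 : ℕ) + 1 / 2) = (N + 1 / 2) * Real.Gamma (N + 1 / 2) := by
  rw [← Real.Gamma_add_one (by positivity)]
  congr 1
  push_cast
  ring

lemma Gamma_add_half_le (N : ℕ) : Real.Gamma (N + 1 / 2) ≤ √Real.pi * N.factorial := by
  induction N with
  | zero => simp [Real.Gamma_one_half_eq, -one_div]
  | succ N ih =>
    rw [Gamma_succ_add_half, Nat.factorial_succ]
    have := Gamma_add_half_nonneg N
    push_cast
    calc ((N : ℝ) + 1 / 2) * Real.Gamma (N + 1 / 2)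
        ≤ (N + 1) * (√Real.pi * N.factorial) := by gcongr; norm_num
      _ = _ := by ring

/-- Both sides are the rising factorial of `1/2` divided by `N!`, since `Γ(1/2) = √π`. -/
lemma ringChoose_half (N : ℕ) :
    Ring.choose ((1 / 2 : ℂ) + N - 1) N =
      (Real.Gamma (N + 1 / 2) / (√Real.pi * N.factorial) : ℝ) := by
  have h1 : Ring.choose ((1 / 2 : ℂ) + N - 1) N = Ring.multichoose (1 / 2 : ℂ) N := by
    rw [Ring.choose]
    congr 1
    ring
  have h2 := Ring.factorial_nsmul_multichoose_eq_ascPochhammer (1 / 2 : ℂ) N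
  have hpi : √Real.pi ≠ 0 := (Real.sqrt_pos.mpr Real.pi_pos).ne'
  have h3 : ∀ n : ℕ, (ascPochhammer ℂ n).eval (1 / 2 : ℂ) =
      (Real.Gamma (n + 1 / 2) / √Real.pi : ℝ) := by
    intro n
    induction n with
    | zero => simp [Real.Gamma_one_half_eq, hpi, -one_div]
    | succ n ih =>
      rw [ascPochhammer_succ_eval, ih, Gamma_succ_add_half]
      push_cast
      ring
  have hN : (N.factorial : ℂ) ≠ 0 := Nat.cast_ne_zero.mpr N.factorial_ne_zero
  rw [Polynomial.ascPochhammer_smeval_eq_eval, h3, nsmul_eq_mul] at h2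
  rw [h1, ← mul_right_inj' hN, h2]
  push_cast
  field_simp

/-- The binomial series of `(1 - z) ^ (-1/2)`. -/
lemma hasSum_one_sub_cpow_half {z : ℂ} (hz : ‖z‖ < 1) :
    HasSum (fun N : ℕ => ((Real.Gamma (N + 1 / 2) / (√Real.pi * N.factorial) : ℝ) : ℂ) * z ^ N)
      (1 / (1 - z) ^ (1 / 2 : ℂ)) := by
  have h := (Complex.one_div_one_sub_cpow_hasFPowerSeriesOnBall_zero (1 / 2)).hasSum (y := z) (by
    simpa [enorm_eq_nnnorm, ← NNReal.coe_lt_coe] using hz)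
  simp only [zero_add] at h
  refine h.congr_fun fun N => ?_
  rw [FormalMultilinearSeries.ofScalars_apply_eq, ringChoose_half, smul_eq_mul]

/-! ## The normalised triple series -/

/-- The general term of the triple series after rescaling `2ω` to `1`. -/
noncomputable def normTerm (u v : ℂ) (j : ℕ → ℂ) (p : ℕ × ℕ × ℕ) : ℂ :=
  ((Real.Gamma (p.1 + p.2.1 + p.2.2 + 1 / 2) : ℂ) /
      (2 ^ (p.1 + p.2.1 + p.2.2) * p.1.factorial * p.2.1.factorial * p.2.2.factorial)) *
    ((-u) ^ p.2.1 * v ^ p.2.2) * (3 * j (3 * p.1 + p.2.1 + 3) - u * j (3 * p.1 + p.2.1 + 1))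

/-- The majorant depends on `u`, `v` only through the bounds `a`, `b`, so it serves both for
convergence at a point and for the locally uniform convergence behind holomorphy. It is summable
when `1/2 + a/2 + b/2 < 1`, that is, `a + b < 1`. -/
lemma norm_normTerm_le {u v : ℂ} {j : ℕ → ℂ} {a b M : ℝ} (hu : ‖u‖ ≤ a) (hv : ‖v‖ ≤ b)
    (ha : a ≤ 1) (hj : ∀ n, ‖j n‖ ≤ M) (p : ℕ × ℕ × ℕ) :
    ‖normTerm u v j p‖ ≤ 4 * M * √Real.pi * (((p.1 + p.2.1 + p.2.2).factorial : ℝ) /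
      (p.1.factorial * p.2.1.factorial * p.2.2.factorial) *
        ((1 / 2) ^ p.1 * (a / 2) ^ p.2.1 * (b / 2) ^ p.2.2)) := by
  obtain ⟨k, l, m⟩ := p
  have hM : 0 ≤ M := (norm_nonneg _).trans (hj 0)
  have ha0 : 0 ≤ a := (norm_nonneg _).trans hu
  have hb0 : 0 ≤ b := (norm_nonneg _).trans hv
  have h1 : ‖3 * j (3 * k + l + 3) - u * j (3 * k + l + 1)‖ ≤ 4 * M := by
    calc _ ≤ ‖3 * j (3 * k + l + 3)‖ + ‖u * j (3 * k + l + 1)‖ := norm_sub_le _ _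
      _ ≤ 3 * M + 1 * M := by
        rw [norm_mul, norm_mul]
        gcongr
        · norm_num
        · exact hj _
        · exact hu.trans ha
        · exact hj _
      _ = 4 * M := by ring
  have hG : ‖(Real.Gamma (k + l + m + 1 / 2) : ℂ)‖ ≤ √Real.pi * (k + l + m).factorial := by
    have := Gamma_add_half_le (k + l + m)
    have h0 := Gamma_add_half_nonneg (k + l + m)
    push_cast at this h0
    rwa [Complex.norm_real, Real.norm_of_nonneg h0]
  simp only [normTerm, norm_mul, norm_div, norm_pow, norm_neg, Complex.norm_natCast,
    Complex.norm_ofNat] at h1 hG ⊢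
  calc _ ≤ √Real.pi * (k + l + m).factorial /
        (2 ^ (k + l + m) * k.factorial * l.factorial * m.factorial) * (a ^ l * b ^ m) *
        (4 * M) := by gcongr
    _ = _ := by
      simp only [div_pow, one_pow]
      field_simp
      ring

lemma summable_normTerm {u v : ℂ} (huv : ‖u‖ + ‖v‖ < 1) {j : ℕ → ℂ} {M : ℝ}
    (hj : ∀ n, ‖j n‖ ≤ M) : Summable (normTerm u v j) := by
  have hu := norm_nonneg u
  have hv := norm_nonneg v
  exact Summable.of_norm_bounded ((summable_trinomial (by norm_num) (by positivity) (by positivity)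
    (by linarith)).mul_left _) (norm_normTerm_le le_rfl le_rfl (by linarith) hj)

end SU3

namespace SU3

open Filter Topology Finset

/-! ## Rescaling -/

section Rescaling

variable {τ : ℍ} {w : ℂ}

lemma g₂_eq_modU (hw : w ≠ 0) : g₂ τ = w ^ 4 * (4 * modU τ w) := by
  rw [modU]; field_simp

lemma g₃_eq_modV (hw : w ≠ 0) : g₃ τ = w ^ 6 * (-4 * modV τ w) := by
  rw [modV]; field_simp

/-- The solutions of the recursion in the units `2ω = 1`. -/
lemma recSol_eq_rescaled (hw : w ≠ 0) (a b : ℂ) (n : ℕ) :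
    recSol (g₂ τ) (g₃ τ) a b n =
      w ^ (2 * n) * recSol (4 * modU τ w) (-4 * modV τ w) a (b / w ^ 2) n := by
  rw [← recSol_scale, ← g₂_eq_modU hw, ← g₃_eq_modV hw, mul_div_cancel₀ _ (pow_ne_zero 2 hw)]

/-- Weight count: `g₂^ℓ g₃^m` supplies `w^(4ℓ+6m)` and `J` supplies `w^(6k+2ℓ+6)`, against
`w^(6(k+ℓ+m)+5)`, leaving one factor `w`; the powers of `4` in `g₂`, `g₃` reduce `2^(k+3ℓ+3m)` to
`2^(k+ℓ+m)`. The factor `s` absorbs the index shift of `L`, and `J` is arbitrary so that pointwise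
powers of `℘` are covered too. -/
lemma coeff_mul_eq (hw : w ≠ 0) {J j : ℕ → ℂ} {s : ℂ} (hJ : ∀ n, J n = s * w ^ (2 * n) * j n)
    (p : ℕ × ℕ × ℕ) :
    coeff τ w p.1 p.2.1 p.2.2 *
      (3 * J (3 * p.1 + p.2.1 + 3) - g₂ τ / 4 * J (3 * p.1 + p.2.1 + 1)) =
      s * w * normTerm (modU τ w) (modV τ w) j p := by
  obtain ⟨k, l, m⟩ := p
  simp only [hJ, coeff, normTerm]
  rw [show g₂ τ / 4 = w ^ 4 * modU τ w by rw [g₂_eq_modU hw]; ring, g₂_eq_modU hw, g₃_eq_modV hw]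
  have e1 : (2 : ℂ) ^ (k + 3 * l + 3 * m) = 2 ^ (k + l + m) * (4 ^ l * 4 ^ m) := by
    rw [show (4 : ℂ) = 2 ^ 2 by norm_num, ← pow_mul, ← pow_mul, ← pow_add, ← pow_add]
    congr 1
    ring
  have e2 : (-1 : ℂ) ^ (l + m) * (w ^ 4 * (4 * modU τ w)) ^ l * (w ^ 6 * (-4 * modV τ w)) ^ m =
      4 ^ l * 4 ^ m * w ^ (4 * l + 6 * m) * ((-modU τ w) ^ l * modV τ w ^ m) := by
    rw [show w ^ 4 * (4 * modU τ w) = -(4 * w ^ 4 * (-modU τ w)) by ring,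
      show w ^ 6 * (-4 * modV τ w) = -(4 * w ^ 6 * modV τ w) by ring,
      neg_pow (4 * w ^ 4 * (-modU τ w)), neg_pow (4 * w ^ 6 * modV τ w), pow_add (-1 : ℂ)]
    have h1 : ((-1 : ℂ) ^ l) * (-1) ^ l = 1 := by rw [← mul_pow]; norm_num
    have h2 : ((-1 : ℂ) ^ m) * (-1) ^ m = 1 := by rw [← mul_pow]; norm_num
    calc _ = ((-1 : ℂ) ^ l * (-1) ^ l) * ((-1) ^ m * (-1) ^ m) *
          ((4 * w ^ 4 * -modU τ w) ^ l * (4 * w ^ 6 * modV τ w) ^ m) := by ring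
      _ = (4 * w ^ 4 * -modU τ w) ^ l * (4 * w ^ 6 * modV τ w) ^ m := by rw [h1, h2]; ring
      _ = _ := by
        rw [mul_pow, mul_pow, mul_pow, mul_pow, pow_add, pow_mul, pow_mul]
        ring
  have e3 : w ^ (4 * l + 6 * m) * w ^ (2 * (3 * k + l + 3)) = w ^ (6 * (k + l + m) + 5) * w := by
    rw [← pow_add, ← pow_succ]
    congr 1
    ring
  have e4 : w ^ (2 * (3 * k + l + 3)) = w ^ (2 * (3 * k + l + 1)) * w ^ 4 := by
    rw [← pow_add]
    congr 1
  have e5 : 3 * (s * w ^ (2 * (3 * k + l + 3)) * j (3 * k + l + 3)) -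
      w ^ 4 * modU τ w * (s * w ^ (2 * (3 * k + l + 1)) * j (3 * k + l + 1)) =
      s * w ^ (2 * (3 * k + l + 3)) *
        (3 * j (3 * k + l + 3) - modU τ w * j (3 * k + l + 1)) := by
    rw [e4]; ring
  rw [e1, e2, e5]
  have e6 : 4 ^ l * 4 ^ m * w ^ (4 * l + 6 * m) * ((-modU τ w) ^ l * modV τ w ^ m) /
      w ^ (6 * (k + l + m) + 5) * (s * w ^ (2 * (3 * k + l + 3))) =
      4 ^ l * 4 ^ m * ((-modU τ w) ^ l * modV τ w ^ m) * (s * w) := by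
    have hne : w ^ (6 * (k + l + m) + 5) ≠ 0 := pow_ne_zero _ hw
    rw [div_mul_eq_mul_div, div_eq_iff hne]
    linear_combination 4 ^ l * 4 ^ m * ((-modU τ w) ^ l * modV τ w ^ m) * s * e3
  rw [← mul_assoc, mul_assoc (_ / _) (_ / _) (_ * _), e6]
  have : (4 : ℂ) ^ l * 4 ^ m ≠ 0 := by simp
  field_simp

lemma periodTerm_eq (hw : w ≠ 0) {J : ℕ → ℂ} (hJ : Recursion (g₂ τ) (g₃ τ) J) (p : ℕ × ℕ × ℕ) :
    periodTerm τ w J p = -Complex.I * (√(2 / Real.pi) : ℝ) * (w *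
      normTerm (modU τ w) (modV τ w)
        (recSol (4 * modU τ w) (-4 * modV τ w) (J 0) (J 1 / w ^ 2)) p) := by
  rw [periodTerm, mul_assoc, coeff_mul_eq hw (s := 1) (fun n => by
    rw [one_mul]; exact (hJ.eq_recSol n).trans (recSol_eq_rescaled hw _ _ n)) p, one_mul]

/-- The shift between `L` and the solution with initial values `0, 1` costs `w⁻²`, turning the
factor `w` into the `w⁻¹` that carries the modular weight. -/
lemma modularTerm_eq (hw : w ≠ 0) (p : ℕ × ℕ × ℕ) :
    modularTerm τ w p = ((-2 / (2 * Real.pi) ^ (3 / 2 : ℝ) : ℝ) : ℂ) * (w⁻¹ *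
      normTerm (modU τ w) (modV τ w) (recSol (4 * modU τ w) (-4 * modV τ w) 0 1) p) := by
  have h := coeff_mul_eq (τ := τ) hw (J := recSol (g₂ τ) (g₃ τ) 0 1) (s := (w ^ 2)⁻¹)
    (j := recSol (4 * modU τ w) (-4 * modV τ w) 0 1) (fun n => by
      rw [recSol_eq_rescaled hw, recSol_eq_combination _ _ 0 (1 / w ^ 2)]
      ring) p
  rw [show (w ^ 2)⁻¹ * w = w⁻¹ by field_simp] at h
  rw [← h, modularTerm, mul_assoc]
  rfl

lemma InDomain.summable_periodTerm (h : InDomain τ w) {J : ℕ → ℂ}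
    (hJ : Recursion (g₂ τ) (g₃ τ) J) : Summable (periodTerm τ w J) := by
  simp only [funext (periodTerm_eq h.1 hJ)]
  exact ((summable_normTerm h.2 (norm_recSol_le h.2.le _ _)).mul_left _).mul_left _

lemma InDomain.summable_modularTerm (h : InDomain τ w) : Summable (modularTerm τ w) := by
  simp only [funext (modularTerm_eq (τ := τ) h.1)]
  exact ((summable_normTerm h.2 (norm_recSol_le h.2.le _ _)).mul_left _).mul_left _

end Rescaling

/-! ## The parametrisation of the curve -/

section Curve

variable {τ : ℍ} {w z : ℂ}

lemma smallFactor_eq (hw : w ≠ 0) (hz : z ∉ (periods τ).lattice) :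
    smallFactor τ w z = wp' τ z ^ 2 / (4 * w ^ 6) := by
  rw [wp'_sq hz, smallFactor, coordX, modU, modV]
  field_simp
  ring

lemma cpow_half_sq (x : ℂ) : (x ^ (1 / 2 : ℂ)) ^ 2 = x := by
  rw [one_div]
  exact Complex.cpow_nat_inv_pow x two_ne_zero

/-- Since `A = P - 1`, the curve reads `y² = P(P - 2)`. Any branch of the root squares correctly, so
no bound on `P` is needed. -/
lemma coord_mem_swCurve (hw : w ≠ 0) (hz : z ∉ (periods τ).lattice) :
    (coordX τ w z, coordY τ w z) ∈ swCurve (modU τ w) (modV τ w) := by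
  have h1 : swA (modU τ w) (modV τ w) (coordX τ w z) = smallFactor τ w z - 1 := by
    rw [swA, smallFactor]; ring
  have h2 : ((√2 : ℝ) : ℂ) ^ 2 = 2 := by
    rw [← Complex.ofReal_pow, Real.sq_sqrt (by norm_num)]; norm_num
  have h3 := smallFactor_eq hw hz
  change coordY τ w z ^ 2 = swA _ _ (coordX τ w z) ^ 2 - 1
  have h4 : coordY τ w z ^ 2 = -2 * (wp' τ z ^ 2 / (4 * w ^ 6)) * (1 - smallFactor τ w z / 2) := by
    rw [coordY, mul_pow, div_pow, mul_pow, mul_pow, cpow_half_sq, h2, Complex.I_sq]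
    field_simp
    ring
  rw [h1, h4, ← h3]
  ring

lemma hasDerivAt_swA (u v x : ℂ) : HasDerivAt (swA u v) (3 * x ^ 2 - u) x := by
  have := ((((hasDerivAt_id x).pow 3).sub ((hasDerivAt_id x).const_mul u)).sub_const (1 - v))
  refine this.congr_deriv ?_
  simp

end Curve

/-! ### Images of cycles on the curve, and their periods. -/

namespace IsCycle

variable {τ : ℍ} {c w : ℂ} {γ : ℝ → ℂ}

lemma continuousOn_smallFactor (hγ : IsCycle τ c γ) :
    ContinuousOn (fun t => smallFactor τ w (γ t)) (Set.Icc 0 1) := by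
  have h : ContinuousOn (fun t => coordX τ w (γ t)) (Set.Icc 0 1) :=
    hγ.continuousOn_wp.div_const _
  exact ((h.pow 3).sub (h.const_mul _)).add_const _

/-- On a short cycle `1 - P/2` stays in the disc of radius `1` about `1`, where the principal root
is continuous and nonzero. The path closes because `x` and `y` are functions of the periodic `℘` and
`℘'`. -/
lemma isClosedPath (hγ : IsCycle τ c γ) (hc : c ∈ (periods τ).lattice) (hw : w ≠ 0)
    (hs : IsShort τ w γ) :
    IsClosedPath (modU τ w) (modV τ w) (fun t => coordX τ w (γ t)) (fun t => coordY τ w (γ t)) := by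
  have hslit : ∀ t ∈ Set.Icc (0 : ℝ) 1, 1 - smallFactor τ w (γ t) / 2 ∈ Complex.slitPlane := by
    intro t ht
    rw [sub_eq_add_neg]
    refine Complex.mem_slitPlane_of_norm_lt_one ?_
    rw [norm_neg, norm_div, Complex.norm_ofNat]
    linarith [(hs t ht).2]
  have h1 : wp τ (γ 1) = wp τ (γ 0) := by
    rw [hγ.end_eq]; exact (periods τ).weierstrassP_add_coe (γ 0) ⟨c, hc⟩
  have h2 : wp' τ (γ 1) = wp' τ (γ 0) := by
    rw [hγ.end_eq]; exact (periods τ).derivWeierstrassP_add_coe (γ 0) ⟨c, hc⟩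
  refine ⟨hγ.continuousOn_wp.div_const _, ?_, fun t ht => coord_mem_swCurve hw (hγ.avoids t ht),
    fun t ht => ?_, ?_, ?_⟩
  · exact ((hγ.continuousOn_wp'.const_mul _).div_const _).mul
      ((continuousOn_const.sub (hγ.continuousOn_smallFactor.div_const _)).cpow
        continuousOn_const hslit)
  · have hP : wp' τ (γ t) ≠ 0 := by
      intro h
      have := (hs t ht).1
      rw [smallFactor_eq hw (hγ.avoids t ht), h] at this
      simp at this
    have h2 : ((√2 : ℝ) : ℂ) ≠ 0 := by
      rw [Complex.ofReal_ne_zero]; positivity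
    refine mul_ne_zero (div_ne_zero (mul_ne_zero Complex.I_ne_zero hP)
      (mul_ne_zero h2 (pow_ne_zero 3 hw))) ?_
    rw [Ne, Complex.cpow_eq_zero_iff]
    exact fun h => Complex.slitPlane_ne_zero (hslit t ht) h.1
  · simp only [coordX, h1]
  · simp only [coordY, smallFactor, coordX, h1, h2]

lemma exists_isShort (hγ : IsCycle τ c γ) (h0 : ∀ t ∈ Set.Icc (0 : ℝ) 1, wp' τ (γ t) ≠ 0) :
    ∃ R : ℝ, ∀ w : ℂ, R < ‖w‖ → InDomain τ w ∧ IsShort τ w γ := by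
  obtain ⟨C, hC⟩ := isCompact_Icc.exists_bound_of_continuousOn hγ.continuousOn_wp'
  -- The summand `1` gives `‖w‖ ≤ ‖w‖⁴, ‖w‖⁶`; the others then make `‖u‖`, `‖v‖` and `‖P‖` each less
  -- than `1/4`.
  refine ⟨1 + ‖g₂ τ‖ + ‖g₃ τ‖ + C ^ 2, fun w hw => ?_⟩
  have hg2 := norm_nonneg (g₂ τ)
  have hg3 := norm_nonneg (g₃ τ)
  have hC2 := sq_nonneg C
  have hw1 : 1 < ‖w‖ := by linarith
  have hw0 : w ≠ 0 := norm_pos_iff.mp (by linarith)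
  have h4 : ‖w‖ ≤ ‖w‖ ^ 4 := le_self_pow₀ hw1.le (by norm_num)
  have h6 : ‖w‖ ≤ ‖w‖ ^ 6 := le_self_pow₀ hw1.le (by norm_num)
  refine ⟨⟨hw0, ?_⟩, fun t ht => ?_⟩
  · rw [modU, modV]
    simp only [norm_div, norm_mul, norm_neg, norm_pow, Complex.norm_ofNat]
    have e1 : ‖g₂ τ‖ / (4 * ‖w‖ ^ 4) < 1 / 4 := by
      rw [div_lt_div_iff₀ (by positivity) (by norm_num)]
      linarith
    have e2 : ‖g₃ τ‖ / (4 * ‖w‖ ^ 6) < 1 / 4 := by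
      rw [div_lt_div_iff₀ (by positivity) (by norm_num)]
      linarith
    linarith
  · rw [smallFactor_eq hw0 (hγ.avoids t ht)]
    simp only [norm_div, norm_mul, norm_pow, Complex.norm_ofNat]
    have hp : 0 < ‖wp' τ (γ t)‖ := norm_pos_iff.mpr (h0 t ht)
    have hb : ‖wp' τ (γ t)‖ ^ 2 ≤ C ^ 2 := by gcongr; exact hC t ht
    refine ⟨by positivity, ?_⟩
    rw [div_lt_iff₀ (by positivity)]
    linarith

/-! ## Expansion of the short periods -/

/-- The holomorphic form `λ` in the elliptic coordinate. -/
lemma shortPeriod_integrand (hγ : IsCycle τ c γ) (hw : w ≠ 0) (hs : IsShort τ w γ) {t : ℝ}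
    (ht : t ∈ Set.Icc (0 : ℝ) 1) :
    coordX τ w (γ t) * deriv (swA (modU τ w) (modV τ w)) (coordX τ w (γ t)) *
        deriv (fun t => coordX τ w (γ t)) t / coordY τ w (γ t) =
      -Complex.I * (√2 : ℝ) * (w ^ 5)⁻¹ *
        (3 * wp τ (γ t) ^ 3 - g₂ τ / 4 * wp τ (γ t)) * deriv γ t *
        (1 / (1 - smallFactor τ w (γ t) / 2) ^ (1 / 2 : ℂ)) := by
  have hd : deriv (fun t => coordX τ w (γ t)) t = wp' τ (γ t) * deriv γ t / w ^ 2 :=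
    (((hasDerivAt_wp (hγ.avoids t ht)).comp t (hγ.hasDerivAt t)).div_const _).deriv
  have hP : wp' τ (γ t) ≠ 0 := by
    intro h
    have := (hs t ht).1
    rw [smallFactor_eq hw (hγ.avoids t ht), h] at this
    simp at this
  have h2 : ((√2 : ℝ) : ℂ) ≠ 0 := by
    rw [Complex.ofReal_ne_zero]; positivity
  rw [hd, (hasDerivAt_swA _ _ _).deriv, coordY, coordX, modU]
  generalize (1 - smallFactor τ w (γ t) / 2) ^ (1 / 2 : ℂ) = s
  -- If the root vanished, both sides would be `0` by the convention for division by zero.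
  rcases eq_or_ne s 0 with rfl | hs0
  · simp
  have hI := Complex.I_ne_zero
  field_simp
  rw [Complex.I_sq]
  ring

/-- The contribution of a triple to the integrand. -/
lemma groupSum_integrand {X d : ℂ} (hw : w ≠ 0) (N : ℕ) :
    groupSum (fun p : ℕ × ℕ × ℕ => -Complex.I * (√(2 / Real.pi) : ℝ) * coeff τ w p.1 p.2.1 p.2.2 *
      (3 * X ^ (3 * p.1 + p.2.1 + 3) - g₂ τ / 4 * X ^ (3 * p.1 + p.2.1 + 1)) * d) N =
    -Complex.I * (√2 : ℝ) * (w ^ 5)⁻¹ * (3 * X ^ 3 - g₂ τ / 4 * X) * d *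
      (((Real.Gamma (N + 1 / 2) / (√Real.pi * N.factorial) : ℝ) : ℂ) *
        (((X / w ^ 2) ^ 3 - modU τ w * (X / w ^ 2) + modV τ w) / 2) ^ N) := by
  have hpi : ((√Real.pi : ℝ) : ℂ) ≠ 0 := by
    rw [Complex.ofReal_ne_zero]; exact (Real.sqrt_pos.mpr Real.pi_pos).ne'
  have hf (n : ℕ) : ((n.factorial : ℕ) : ℂ) ≠ 0 := Nat.cast_ne_zero.mpr n.factorial_ne_zero
  rw [show ((X / w ^ 2) ^ 3 - modU τ w * (X / w ^ 2) + modV τ w) / 2 =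
    (X / w ^ 2) ^ 3 / 2 + -(modU τ w * (X / w ^ 2)) / 2 + modV τ w / 2 by ring,
    ← groupSum_trinomial, groupSum, groupSum, Finset.mul_sum, Finset.mul_sum]
  refine Finset.sum_congr rfl fun p hp => ?_
  rw [Finset.mul_sum, Finset.mul_sum]
  refine Finset.sum_congr rfl fun q hq => ?_
  obtain ⟨k, s⟩ := p
  obtain ⟨l, m⟩ := q
  obtain rfl := mem_antidiagonal.mp hq
  obtain rfl := mem_antidiagonal.mp hp
  -- The rescaling identity is applied to the integrand, with powers of `X` in place of cycle
  -- integrals.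
  have h := coeff_mul_eq (τ := τ) hw (J := fun n => X ^ n) (j := fun n => (X / w ^ 2) ^ n) (s := 1)
    (fun n => by rw [div_pow, ← pow_mul]; field_simp) (k, l, m)
  simp only at h ⊢
  rw [mul_assoc (_ * _) (coeff _ _ _ _ _), h, normTerm, Real.sqrt_div (by norm_num)]
  have hX : (w ^ 5)⁻¹ * (3 * X ^ 3 - g₂ τ / 4 * X) =
      w * (3 * (X / w ^ 2) ^ 3 - modU τ w * (X / w ^ 2)) := by
    rw [modU]
    field_simp
  rw [mul_assoc (-Complex.I * _) (w ^ 5)⁻¹, hX]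
  generalize X / w ^ 2 = x
  generalize modU τ w = u
  generalize modV τ w = v
  have hN := hf (k + l + m)
  rw [show -(u * x) / 2 = (-u) * x / 2 by ring]
  simp only [div_pow, mul_pow, ← add_assoc, pow_add, pow_mul, pow_one]
  push_cast
  have hfk := hf k
  have hfl := hf l
  have hfm := hf m
  have h2 (n : ℕ) : (2 : ℂ) ^ n ≠ 0 := by simp
  have h2k := h2 k
  have h2l := h2 l
  have h2m := h2 m
  generalize (Real.Gamma _ : ℂ) = Γ'
  generalize (k.factorial : ℂ) = fk at *
  generalize (l.factorial : ℂ) = fl at *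
  generalize (m.factorial : ℂ) = fm at *
  generalize ((k + l + m).factorial : ℂ) = fN at *
  generalize (2 : ℂ) ^ k = a2 at *
  generalize (2 : ℂ) ^ l = b2 at *
  generalize (2 : ℂ) ^ m = c2 at *
  generalize (x ^ 3) ^ k = xk
  generalize x ^ l = xl
  generalize (-u) ^ l = ul
  generalize v ^ m = vm
  generalize ((√Real.pi : ℝ) : ℂ) = r at *
  clear h hX hf h2
  field_simp

/-- Two different smallness conditions enter. Shortness gives `|P|/2 ≤ ρ < 1` on the compact path,
so the series in `N` is dominated by `C ρ^N` and can be integrated termwise; `|u| + |v| < 1` makes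
the triple family summable, so the groups can be broken up. -/
lemma hasSum_periodTerm (hγ : IsCycle τ c γ) (hc : c ∈ (periods τ).lattice)
    (hD : InDomain τ w) (hs : IsShort τ w γ) :
    HasSum (periodTerm τ w (cycleIntegral τ γ)) (shortPeriod τ w γ) := by
  have hw := hD.1
  refine hasSum_of_hasSum_groupSum
    (hD.summable_periodTerm (hγ.recursion_cycleIntegral hc)) ?_
  have h01 : Set.uIoc (0 : ℝ) 1 ⊆ Set.Icc 0 1 := by
    rw [Set.uIoc_of_le zero_le_one]; exact Set.Ioc_subset_Icc_self
  -- the terms as integrals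
  set T : ℕ × ℕ × ℕ → ℝ → ℂ := fun p t =>
    -Complex.I * (√(2 / Real.pi) : ℝ) * coeff τ w p.1 p.2.1 p.2.2 *
      (3 * wp τ (γ t) ^ (3 * p.1 + p.2.1 + 3) -
        g₂ τ / 4 * wp τ (γ t) ^ (3 * p.1 + p.2.1 + 1)) * deriv γ t
  have hT : ∀ p, IntervalIntegrable (T p) MeasureTheory.volume 0 1 := by
    intro p
    refine ContinuousOn.intervalIntegrable ?_
    rw [Set.uIcc_of_le zero_le_one]
    exact (continuousOn_const.mul ((continuousOn_const.mul (hγ.continuousOn_wp.pow _)).sub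
      (continuousOn_const.mul (hγ.continuousOn_wp.pow _)))).mul hγ.continuous_deriv.continuousOn
  have hterm : ∀ p, periodTerm τ w (cycleIntegral τ γ) p =
      (2 * Real.pi * Complex.I)⁻¹ * ∫ t in (0 : ℝ)..1, T p t := by
    intro p
    have e : ∀ t, T p t = -Complex.I * (√(2 / Real.pi) : ℝ) * coeff τ w p.1 p.2.1 p.2.2 *
        (3 * (wp τ (γ t) ^ (3 * p.1 + p.2.1 + 3) * deriv γ t) -
        g₂ τ / 4 * (wp τ (γ t) ^ (3 * p.1 + p.2.1 + 1) * deriv γ t)) := fun t => by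
      simp only [T]; ring
    simp only [e]
    rw [intervalIntegral.integral_const_mul, intervalIntegral.integral_sub
      ((hγ.intervalIntegrable_wp_pow _).const_mul _) ((hγ.intervalIntegrable_wp_pow _).const_mul _),
      intervalIntegral.integral_const_mul, intervalIntegral.integral_const_mul, periodTerm,
      cycleIntegral, cycleIntegral]
    ring
  set B : ℝ → ℂ := fun t => -Complex.I * (√2 : ℝ) * (w ^ 5)⁻¹ *
    (3 * wp τ (γ t) ^ 3 - g₂ τ / 4 * wp τ (γ t)) * deriv γ t
  have hB : ContinuousOn B (Set.Icc 0 1) :=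
    (continuousOn_const.mul ((continuousOn_const.mul (hγ.continuousOn_wp.pow _)).sub
      (continuousOn_const.mul hγ.continuousOn_wp))).mul hγ.continuous_deriv.continuousOn
  set a : ℕ → ℝ := fun N => Real.Gamma (N + 1 / 2) / (√Real.pi * N.factorial)
  have hgroup : ∀ N, groupSum (periodTerm τ w (cycleIntegral τ γ)) N =
      (2 * Real.pi * Complex.I)⁻¹ *
        ∫ t in (0 : ℝ)..1, B t * ((a N : ℂ) * (smallFactor τ w (γ t) / 2) ^ N) := by
    intro N
    have e : ∀ t, B t * ((a N : ℂ) * (smallFactor τ w (γ t) / 2) ^ N) =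
        groupSum (fun p => T p t) N := fun t =>
      (groupSum_integrand (τ := τ) (X := wp τ (γ t)) (d := deriv γ t) hw N).symm
    simp only [e, ← sum_sigmaTripleEquiv, hterm]
    rw [intervalIntegral.integral_finsetSum fun x _ => hT _, Finset.mul_sum]
  rw [funext hgroup, shortPeriod, swPeriod]
  refine HasSum.mul_left _ ?_
  rw [intervalIntegral.integral_congr (g := fun t =>
    B t * (1 / (1 - smallFactor τ w (γ t) / 2) ^ (1 / 2 : ℂ))) (fun t ht => by
      rw [Set.uIcc_of_le zero_le_one] at ht
      exact hγ.shortPeriod_integrand hw hs ht)]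
  -- a uniform bound on the path
  obtain ⟨C, hC⟩ := isCompact_Icc.exists_bound_of_continuousOn hB
  obtain ⟨t₀, ht₀, hmax⟩ := isCompact_Icc.exists_isMaxOn (Set.nonempty_Icc.mpr zero_le_one)
    (hγ.continuousOn_smallFactor (w := w)).norm
  set ρ := ‖smallFactor τ w (γ t₀)‖ / 2
  have hρ1 : ρ < 1 := by have := (hs t₀ ht₀).2; simp only [ρ]; linarith
  have hρ0 : 0 ≤ ρ := by positivity
  have hρ : ∀ t ∈ Set.Icc (0 : ℝ) 1, ‖smallFactor τ w (γ t) / 2‖ ≤ ρ := by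
    intro t ht
    have : ‖smallFactor τ w (γ t)‖ ≤ ‖smallFactor τ w (γ t₀)‖ := hmax ht
    rw [norm_div, Complex.norm_ofNat]
    simp only [ρ]
    linarith
  have ha0 : ∀ N, 0 ≤ a N := fun N => div_nonneg (Gamma_add_half_nonneg N) (by positivity)
  have ha1 : ∀ N, a N ≤ 1 := fun N =>
    div_le_one_of_le₀ (Gamma_add_half_le N) (by positivity)
  have hC0 : 0 ≤ C := (norm_nonneg _).trans (hC 0 (by simp))
  refine intervalIntegral.hasSum_integral_of_dominated_convergence
    (fun N _ => C * ρ ^ N) (fun N => ?_) (fun N => .of_forall fun t ht => ?_)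
    (.of_forall fun t _ => (summable_geometric_of_lt_one hρ0 hρ1).mul_left C)
    intervalIntegrable_const (.of_forall fun t ht => ?_)
  · refine (ContinuousOn.aestronglyMeasurable ?_ measurableSet_uIoc)
    exact (hB.mul (continuousOn_const.mul
      ((hγ.continuousOn_smallFactor.div_const _).pow N))).mono h01
  · rw [norm_mul (B t), norm_mul (a N : ℂ), norm_pow, Complex.norm_real, Real.norm_of_nonneg (ha0 N)]
    have h1 := hC t (h01 ht)
    have h2 := hρ t (h01 ht)
    calc _ ≤ C * (1 * ρ ^ N) := by gcongr; exact ha1 N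
      _ = _ := by ring
  · exact (hasSum_one_sub_cpow_half ((hρ t (h01 ht)).trans_lt hρ1)).mul_left _

end IsCycle

end SU3

/-! ## Series of holomorphic functions of several variables -/

section SeveralVariables

open Metric

variable {E : Type*} [NormedAddCommGroup E] [NormedSpace ℂ E]

/-- Cauchy's estimate for the derivative of a bounded holomorphic function. -/
lemma norm_fderiv_le_of_forall_mem_closedBall {f : E → ℂ} {y : E} {r M : ℝ} (hr : 0 < r)
    (hf : ∀ x ∈ closedBall y r, DifferentiableAt ℂ f x) (hM : ∀ x ∈ closedBall y r, ‖f x‖ ≤ M) :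
    ‖fderiv ℂ f y‖ ≤ M / r := by
  have hM0 : 0 ≤ M := (norm_nonneg _).trans (hM y (mem_closedBall_self hr.le))
  refine ContinuousLinearMap.opNorm_le_bound _ (by positivity) fun h => ?_
  rcases eq_or_ne h 0 with rfl | hh
  · simp
  have hh' : 0 < ‖h‖ := norm_pos_iff.mpr hh
  -- Restricting `f` to the complex line through `y` in direction `h` reduces to the one-variable
  -- estimate on a disc of radius `r / ‖h‖`.
  have hmem : ∀ z ∈ closedBall (0 : ℂ) (r / ‖h‖), y + z • h ∈ closedBall y r := by
    intro z hz
    rw [mem_closedBall_zero_iff, le_div_iff₀ hh'] at hz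
    rwa [mem_closedBall, dist_eq_norm, add_sub_cancel_left, norm_smul]
  have hline : ∀ z : ℂ, HasDerivAt (fun z : ℂ => y + z • h) h z := fun z => by
    simpa using ((hasDerivAt_id z).smul_const h).const_add y
  have hd : ∀ z ∈ closedBall (0 : ℂ) (r / ‖h‖),
      HasDerivAt (fun z : ℂ => f (y + z • h)) (fderiv ℂ f (y + z • h) h) z := fun z hz =>
    (hf _ (hmem z hz)).hasFDerivAt.comp_hasDerivAt z (hline z)
  have hR : 0 < r / ‖h‖ := by positivity
  have h1 := Complex.norm_deriv_le_of_forall_mem_sphere_norm_le hR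
    (f := fun z : ℂ => f (y + z • h)) (c := 0) (C := M)
    (DifferentiableOn.diffContOnCl fun z hz => (hd z (by
      rwa [closure_ball _ hR.ne'] at hz)).differentiableAt.differentiableWithinAt)
    fun z hz => hM _ (hmem z (sphere_subset_closedBall hz))
  rw [(hd 0 (mem_closedBall_self hR.le)).deriv, zero_smul, add_zero] at h1
  calc _ ≤ M / (r / ‖h‖) := h1
    _ = M / r * ‖h‖ := by field_simp

/-- By Cauchy's estimate on balls of radius `ε/4` centred in the ball of radius `ε/2`, all inside
`U`, the derivatives are dominated by `u i / (ε/4)`, so the series can be differentiated term by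
term. -/
lemma differentiableOn_tsum_of_summable_norm' {ι : Type*} {f : ι → E → ℂ} {u : ι → ℝ} {U : Set E}
    (hU : IsOpen U) (hu : Summable u) (hf : ∀ i, DifferentiableOn ℂ (f i) U)
    (hb : ∀ i, ∀ x ∈ U, ‖f i x‖ ≤ u i) : DifferentiableOn ℂ (fun x => ∑' i, f i x) U := by
  intro x hx
  obtain ⟨ε, hε, hball⟩ := Metric.isOpen_iff.mp hU x hx
  have hsub : ∀ y ∈ ball x (ε / 2), closedBall y (ε / 4) ⊆ U := fun y hy z hz => hball (by
    rw [mem_ball] at hy ⊢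
    rw [mem_closedBall] at hz
    linarith [dist_triangle z y x])
  have hd : ∀ i, ∀ y ∈ U, DifferentiableAt ℂ (f i) y := fun i y hy =>
    (hf i).differentiableAt (hU.mem_nhds hy)
  have hx' : x ∈ ball x (ε / 2) := mem_ball_self (by positivity)
  exact (hasFDerivAt_tsum_of_isPreconnected (hu.div_const (ε / 4)) isOpen_ball
    ((convex_ball x (ε / 2)).isPreconnected)
    (fun i y hy => (hd i y (hsub y hy (mem_closedBall_self (by positivity)))).hasFDerivAt)
    (fun i y hy => norm_fderiv_le_of_forall_mem_closedBall (by positivity)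
      (fun z hz => hd i z (hsub y hy hz)) fun z hz => hb i z (hsub y hy hz))
    hx' (Summable.of_norm_bounded hu fun i => hb i x hx) hx').differentiableAt.differentiableWithinAt

end SeveralVariables

namespace SU3

open Filter Topology

/-! ## The difference `a_D - τ a` -/

lemma period_const_mul :
    -Complex.I * (√(2 / Real.pi) : ℝ) * (1 / (2 * Real.pi * Complex.I)) =
      ((-2 / (2 * Real.pi) ^ (3 / 2 : ℝ) : ℝ) : ℂ) := by
  have h1 : (2 * Real.pi) ^ (3 / 2 : ℝ) = 2 * Real.pi * (√2 * √Real.pi) := by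
    rw [show (3 / 2 : ℝ) = 1 + 1 / 2 by norm_num, Real.rpow_add (by positivity), Real.rpow_one,
      ← Real.sqrt_eq_rpow, Real.sqrt_mul (by norm_num)]
  have hs : ((√2 : ℝ) : ℂ) * (√2 : ℝ) = 2 := by
    rw [← Complex.ofReal_mul, Real.mul_self_sqrt (by norm_num)]; norm_num
  have h2 : ((√2 : ℝ) : ℂ) ≠ 0 := by rw [Complex.ofReal_ne_zero]; positivity
  have hp : ((√Real.pi : ℝ) : ℂ) ≠ 0 := by
    rw [Complex.ofReal_ne_zero]; exact (Real.sqrt_pos.mpr Real.pi_pos).ne'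
  have hp' : (Real.pi : ℂ) ≠ 0 := by exact_mod_cast Real.pi_ne_zero
  have hI := Complex.I_ne_zero
  rw [h1, Real.sqrt_div (by norm_num)]
  push_cast
  field_simp
  linear_combination -hs

/-- Only the indices `3k+ℓ+3` and `3k+ℓ+1` occur, both positive, so each `Bₙ - τ Aₙ` is `1/(2πi)`
times `Lₙ₋₁` and `E₂` cancels term by term. -/
lemma hasSum_modularTerm {τ : ℍ} {w : ℂ} {γA γB : ℝ → ℂ} (hD : InDomain τ w)
    (hA : IsACycle τ γA) (hAs : IsShort τ w γA) (hB : IsBCycle τ γB) (hBs : IsShort τ w γB) :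
    HasSum (modularTerm τ w) (shortPeriod τ w γB - τ * shortPeriod τ w γA) := by
  have h1 := IsCycle.hasSum_periodTerm hA (two_pi_I_mem_lattice τ) hD hAs
  have h2 := IsCycle.hasSum_periodTerm hB (two_pi_I_mul_mem_lattice τ) hD hBs
  refine (h2.sub (h1.mul_left (τ : ℂ))).congr_fun fun p => ?_
  rw [modularTerm, periodTerm, periodTerm, ← period_const_mul]
  rw [hB.cycleIntegral_succ hA (3 * p.1 + p.2.1 + 2), hB.cycleIntegral_succ hA (3 * p.1 + p.2.1)]
  ring

/-! ## Holomorphy and modularity -/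

/-- The series for `a_D - τ a` as a function of the moduli. -/
noncomputable def modularModuliSum (q : ℂ × ℂ) : ℂ :=
  ∑' p, normTerm q.1 q.2 (recSol (4 * q.1) (-4 * q.2) 0 1) p

lemma modularSum_eq {τ : ℍ} {w : ℂ} (hw : w ≠ 0) :
    modularSum τ w = ((-2 / (2 * Real.pi) ^ (3 / 2 : ℝ) : ℝ) : ℂ) *
      (w⁻¹ * modularModuliSum (modU τ w, modV τ w)) := by
  rw [modularSum, modularModuliSum]
  simp only [funext (modularTerm_eq (τ := τ) hw)]
  rw [tsum_mul_left, tsum_mul_left]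

lemma differentiable_recSol (a b : ℂ) :
    ∀ n, Differentiable ℂ (fun q : ℂ × ℂ => recSol (4 * q.1) (-4 * q.2) a b n)
  | 0 => by simp only [recSol]; fun_prop
  | 1 => by simp only [recSol]; fun_prop
  | 2 => by simp only [recSol]; fun_prop
  | n + 3 => by
    have h1 := differentiable_recSol a b (n + 1)
    have h0 := differentiable_recSol a b n
    simp only [recSol]
    fun_prop

lemma differentiable_normTerm (a b : ℂ) (p : ℕ × ℕ × ℕ) :
    Differentiable ℂ fun q : ℂ × ℂ => normTerm q.1 q.2 (recSol (4 * q.1) (-4 * q.2) a b) p := by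
  have h3 := differentiable_recSol a b (3 * p.1 + p.2.1 + 3)
  have h1 := differentiable_recSol a b (3 * p.1 + p.2.1 + 1)
  simp only [normTerm]
  fun_prop

lemma differentiableAt_modularModuliSum {q : ℂ × ℂ} (hq : ‖q.1‖ + ‖q.2‖ < 1) :
    DifferentiableAt ℂ modularModuliSum q := by
  -- Enlarging both radii by `ε` uses half of the gap to `1`, so one summable majorant works on a
  -- whole polydisc around `q`.
  set ε := (1 - (‖q.1‖ + ‖q.2‖)) / 4
  have hε : 0 < ε := by simp only [ε]; linarith
  have hε' : ε * 4 = 1 - (‖q.1‖ + ‖q.2‖) := by simp only [ε]; ring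
  have h1 := norm_nonneg q.1
  have h2 := norm_nonneg q.2
  have hU : IsOpen {x : ℂ × ℂ | ‖x.1‖ < ‖q.1‖ + ε ∧ ‖x.2‖ < ‖q.2‖ + ε} :=
    (isOpen_lt continuous_fst.norm continuous_const).inter
      (isOpen_lt continuous_snd.norm continuous_const)
  have hbound : ∀ x : ℂ × ℂ, ‖x.1‖ < ‖q.1‖ + ε ∧ ‖x.2‖ < ‖q.2‖ + ε → ‖x.1‖ + ‖x.2‖ ≤ 1 :=
    fun x hx => by linarith [hx.1, hx.2]
  refine (differentiableOn_tsum_of_summable_norm' hU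
    ((summable_trinomial (x := 1 / 2) (y := (‖q.1‖ + ε) / 2) (z := (‖q.2‖ + ε) / 2) (by norm_num)
      (by positivity) (by positivity) (by linarith)).mul_left _)
    (fun p => (differentiable_normTerm 0 1 p).differentiableOn)
    (fun p x hx => norm_normTerm_le hx.1.le hx.2.le (by linarith)
      (norm_recSol_le (hbound x hx) 0 1) p)).differentiableAt (hU.mem_nhds ?_)
  exact ⟨by linarith, by linarith⟩

lemma IsModular.differentiableAt {k : ℤ} {F : ℍ → ℂ} (hF : IsModular k F) {z : ℂ}
    (hz : 0 < z.im) : DifferentiableAt ℂ (fun z => F (UpperHalfPlane.ofComplex z)) z := by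
  obtain ⟨f, hf⟩ := hF
  rw [← funext hf]
  exact (UpperHalfPlane.mdifferentiable_iff.mp (ModularFormClass.holo f)).differentiableAt
    (UpperHalfPlane.isOpen_upperHalfPlaneSet.mem_nhds hz)

lemma IsModular.smul_eq {k : ℤ} {F : ℍ → ℂ} (hF : IsModular k F) (γ : SL(2, ℤ)) (τ : ℍ) :
    F (γ • τ) = UpperHalfPlane.denom γ τ ^ k * F τ := by
  obtain ⟨f, hf⟩ := hF
  rw [← funext hf]
  exact SlashInvariantForm.slash_action_eqn'' f
    (γ := Matrix.SpecialLinearGroup.mapGL ℝ γ) (MonoidHom.mem_range.mpr ⟨γ, rfl⟩) τ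

lemma differentiableAt_modU {p : ℂ × ℂ} (h : 0 < p.1.im) (hw : p.2 ≠ 0) :
    DifferentiableAt ℂ (fun p : ℂ × ℂ => modU (UpperHalfPlane.ofComplex p.1) p.2) p := by
  have h2 : DifferentiableAt ℂ (fun p : ℂ × ℂ => g₂ (UpperHalfPlane.ofComplex p.1)) p :=
    (isModular_g₂.differentiableAt h).comp p differentiableAt_fst
  have h4 : DifferentiableAt ℂ (fun p : ℂ × ℂ => 4 * p.2 ^ 4) p := by fun_prop
  simp only [modU, div_eq_mul_inv]
  exact h2.fun_mul (h4.fun_inv (mul_ne_zero (by norm_num) (pow_ne_zero 4 hw)))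

lemma differentiableAt_modV {p : ℂ × ℂ} (h : 0 < p.1.im) (hw : p.2 ≠ 0) :
    DifferentiableAt ℂ (fun p : ℂ × ℂ => modV (UpperHalfPlane.ofComplex p.1) p.2) p := by
  have h2 : DifferentiableAt ℂ (fun p : ℂ × ℂ => g₃ (UpperHalfPlane.ofComplex p.1)) p :=
    (isModular_g₃.differentiableAt h).comp p differentiableAt_fst
  have h4 : DifferentiableAt ℂ (fun p : ℂ × ℂ => 4 * p.2 ^ 6) p := by fun_prop
  simp only [modV, div_eq_mul_inv]
  exact h2.fun_neg.fun_mul (h4.fun_inv (mul_ne_zero (by norm_num) (pow_ne_zero 6 hw)))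

lemma mem_domain_iff {p : ℂ × ℂ} :
    p ∈ domain ↔ 0 < p.1.im ∧ InDomain (UpperHalfPlane.ofComplex p.1) p.2 := by
  constructor
  · rintro ⟨h, hD⟩
    rw [← UpperHalfPlane.ofComplex_apply_of_im_pos h] at hD
    exact ⟨h, hD⟩
  · rintro ⟨h, hD⟩
    rw [UpperHalfPlane.ofComplex_apply_of_im_pos h] at hD
    exact ⟨h, hD⟩

lemma isOpen_domain : IsOpen domain := by
  rw [isOpen_iff_mem_nhds]
  intro p hp
  obtain ⟨h, hw, huv⟩ := mem_domain_iff.mp hp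
  have hc := ((differentiableAt_modU h hw).continuousAt.norm.add
    (differentiableAt_modV h hw).continuousAt.norm).eventually_lt continuousAt_const huv
  have him : ∀ᶠ q : ℂ × ℂ in 𝓝 p, 0 < q.1.im :=
    (isOpen_lt continuous_const (by fun_prop)).mem_nhds h
  have hne : ∀ᶠ q : ℂ × ℂ in 𝓝 p, q.2 ≠ 0 := continuousAt_snd.eventually_ne hw
  filter_upwards [hc, him, hne] with q h1 h2 h3
  exact mem_domain_iff.mpr ⟨h2, h3, h1⟩

lemma differentiableOn_modularSum : DifferentiableOn ℂ
    (fun p : ℂ × ℂ => modularSum (UpperHalfPlane.ofComplex p.1) p.2) domain := by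
  have heq : Set.EqOn (fun p : ℂ × ℂ => modularSum (UpperHalfPlane.ofComplex p.1) p.2)
      (fun p => ((-2 / (2 * Real.pi) ^ (3 / 2 : ℝ) : ℝ) : ℂ) * (p.2⁻¹ * modularModuliSum
        (modU (UpperHalfPlane.ofComplex p.1) p.2, modV (UpperHalfPlane.ofComplex p.1) p.2)))
      domain := fun p hp => modularSum_eq (mem_domain_iff.mp hp).2.1
  refine DifferentiableOn.congr (fun p hp => ?_) heq
  obtain ⟨h, hw, huv⟩ := mem_domain_iff.mp hp
  have h1 : DifferentiableAt ℂ (fun p : ℂ × ℂ => modularModuliSum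
      (modU (UpperHalfPlane.ofComplex p.1) p.2, modV (UpperHalfPlane.ofComplex p.1) p.2)) p :=
    DifferentiableAt.comp (g := modularModuliSum) p (differentiableAt_modularModuliSum huv)
      ((differentiableAt_modU h hw).prodMk (differentiableAt_modV h hw))
  exact ((((differentiableAt_snd).fun_inv hw).fun_mul h1).const_mul _).differentiableWithinAt

lemma modU_smul (τ : ℍ) (w : ℂ) (γ : SL(2, ℤ)) :
    modU (γ • τ) (UpperHalfPlane.denom γ τ * w) = modU τ w := by
  have := UpperHalfPlane.denom_ne_zero γ τ
  rw [modU, modU, isModular_g₂.smul_eq, mul_pow, zpow_ofNat]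
  field_simp

lemma modV_smul (τ : ℍ) (w : ℂ) (γ : SL(2, ℤ)) :
    modV (γ • τ) (UpperHalfPlane.denom γ τ * w) = modV τ w := by
  have := UpperHalfPlane.denom_ne_zero γ τ
  rw [modV, modV, isModular_g₃.smul_eq, mul_pow, zpow_ofNat]
  field_simp

lemma InDomain.smul {τ : ℍ} {w : ℂ} (h : InDomain τ w) (γ : SL(2, ℤ)) :
    InDomain (γ • τ) (UpperHalfPlane.denom γ τ * w) :=
  ⟨mul_ne_zero (UpperHalfPlane.denom_ne_zero γ τ) h.1, by rw [modU_smul, modV_smul]; exact h.2⟩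

/-- The moduli `u` and `v` are unchanged, so only the prefactor `w⁻¹` transforms. -/
lemma modularSum_smul {τ : ℍ} {w : ℂ} (hw : w ≠ 0) (γ : SL(2, ℤ)) :
    modularSum (γ • τ) (UpperHalfPlane.denom γ τ * w) =
      (UpperHalfPlane.denom γ τ)⁻¹ * modularSum τ w := by
  rw [modularSum_eq hw, modularSum_eq (mul_ne_zero (UpperHalfPlane.denom_ne_zero γ τ) hw),
    modU_smul, modV_smul, mul_inv]
  ring

end SU3

theorem mainTheorem6 :
    -- the invariants and the parametrisation of the curve
    (∀ τ : ℍ, SU3.g₂ τ = ModularForm.E₄ τ / 12 ∧ SU3.g₃ τ = -ModularForm.E₆ τ / 216) ∧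
    (∀ (τ : ℍ) (w z : ℂ), w ≠ 0 → z ∉ (SU3.periods τ).lattice →
      SU3.wp' τ z ^ 2 = 4 * SU3.wp τ z ^ 3 - SU3.g₂ τ * SU3.wp τ z - SU3.g₃ τ ∧
      SU3.smallFactor τ w z = SU3.wp' τ z ^ 2 / (4 * w ^ 6) ∧
      (SU3.coordX τ w z, SU3.coordY τ w z) ∈ SU3.swCurve (SU3.modU τ w) (SU3.modV τ w)) ∧
    -- the cycle integrals: recursion, initial conditions, expression through `E₂`, `E₄`, `E₆`
    (∀ (τ : ℍ) (γA γB : ℝ → ℂ), SU3.IsACycle τ γA → SU3.IsBCycle τ γB →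
      SU3.cycleIntegral τ γA 0 = 1 ∧ SU3.cycleIntegral τ γB 0 = τ ∧
      SU3.Recursion (SU3.g₂ τ) (SU3.g₃ τ) (SU3.cycleIntegral τ γA) ∧
      SU3.Recursion (SU3.g₂ τ) (SU3.g₃ τ) (SU3.cycleIntegral τ γB) ∧
      ∀ n : ℕ,
        SU3.cycleIntegral τ γA (n + 1) =
          SU3.K (n + 1) τ + EisensteinSeries.E2 τ / 12 * SU3.L n τ ∧
        SU3.cycleIntegral τ γB (n + 1) =
          τ * SU3.cycleIntegral τ γA (n + 1) + 1 / (2 * Real.pi * Complex.I) * SU3.L n τ) ∧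
    (∀ n : ℕ,
      (∃ f : ModularForm 𝒮ℒ (2 * n), ∀ τ : ℍ, f τ = SU3.K n τ) ∧
      (∃ f : ModularForm 𝒮ℒ (2 * n), ∀ τ : ℍ, f τ = SU3.L n τ) ∧
      (∃ P : MvPolynomial (Fin 2) ℚ, P.IsWeightedHomogeneous ![4, 6] (2 * n) ∧
        ∀ τ : ℍ, SU3.K n τ = P.aeval ![ModularForm.E₄ τ, ModularForm.E₆ τ]) ∧
      (∃ P : MvPolynomial (Fin 2) ℚ, P.IsWeightedHomogeneous ![4, 6] (2 * n) ∧
        ∀ τ : ℍ, SU3.L n τ = P.aeval ![ModularForm.E₄ τ, ModularForm.E₆ τ])) ∧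
    -- cycles off the branch points exist, and are short cycles for all large `ω`
    (∀ τ : ℍ, ∃ γA γB : ℝ → ℂ, SU3.IsACycle τ γA ∧ SU3.IsBCycle τ γB ∧
      ∀ t ∈ Set.Icc (0 : ℝ) 1, SU3.wp' τ (γA t) ≠ 0 ∧ SU3.wp' τ (γB t) ≠ 0) ∧
    (∀ (τ : ℍ) (γ : ℝ → ℂ), SU3.IsACycle τ γ ∨ SU3.IsBCycle τ γ →
      (∀ t ∈ Set.Icc (0 : ℝ) 1, SU3.wp' τ (γ t) ≠ 0) →
      ∃ R : ℝ, ∀ w : ℂ, R < ‖w‖ → SU3.InDomain τ w ∧ SU3.IsShort τ w γ) ∧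
    -- the expansions of the short periods `a`, `a_D` and of `a_D - τ a`
    (∀ (τ : ℍ) (w : ℂ) (γA γB : ℝ → ℂ), SU3.InDomain τ w →
      SU3.IsACycle τ γA → SU3.IsShort τ w γA → SU3.IsBCycle τ γB → SU3.IsShort τ w γB →
      SU3.IsClosedPath (SU3.modU τ w) (SU3.modV τ w)
        (fun t => SU3.coordX τ w (γA t)) (fun t => SU3.coordY τ w (γA t)) ∧
      SU3.IsClosedPath (SU3.modU τ w) (SU3.modV τ w)
        (fun t => SU3.coordX τ w (γB t)) (fun t => SU3.coordY τ w (γB t)) ∧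
      HasSum (SU3.periodTerm τ w (SU3.cycleIntegral τ γA)) (SU3.shortPeriod τ w γA) ∧
      HasSum (SU3.periodTerm τ w (SU3.cycleIntegral τ γB)) (SU3.shortPeriod τ w γB) ∧
      HasSum (SU3.modularTerm τ w) (SU3.shortPeriod τ w γB - τ * SU3.shortPeriod τ w γA)) ∧
    -- the series for `a_D - τ a` is holomorphic and modular of weight `-1`
    (∀ (τ : ℍ) (w : ℂ), SU3.InDomain τ w → Summable (SU3.modularTerm τ w)) ∧
    IsOpen SU3.domain ∧
    DifferentiableOn ℂ
      (fun p : ℂ × ℂ => SU3.modularSum (UpperHalfPlane.ofComplex p.1) p.2) SU3.domain ∧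
    (∀ (τ : ℍ) (w : ℂ) (γ : SL(2, ℤ)), SU3.InDomain τ w →
      SU3.InDomain (γ • τ) (UpperHalfPlane.denom γ τ * w) ∧
      SU3.modularSum (γ • τ) (UpperHalfPlane.denom γ τ * w) =
        (UpperHalfPlane.denom γ τ)⁻¹ * SU3.modularSum τ w) := by

  refine ⟨fun τ => ⟨SU3.g₂_eq τ, SU3.g₃_eq τ⟩, fun τ w z hw hz => ⟨SU3.wp'_sq hz,
    SU3.smallFactor_eq hw hz, SU3.coord_mem_swCurve hw hz⟩, fun τ γA γB hA hB =>
    ⟨hA.cycleIntegral_zero, hB.cycleIntegral_zero, hA.recursion, hB.recursion,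
      fun n => ⟨hA.cycleIntegral_succ n, hB.cycleIntegral_succ hA n⟩⟩,
    fun n => ⟨SU3.isModular_K n, SU3.isModular_L n, SU3.isEisensteinPolynomial_K n,
      SU3.isEisensteinPolynomial_L n⟩, fun τ => ?_, fun τ γ hγ h0 => ?_,
    fun τ w γA γB hD hA hAs hB hBs => ⟨?_, ?_, ?_, ?_,
      SU3.hasSum_modularTerm hD hA hAs hB hBs⟩,
    fun τ w h => h.summable_modularTerm, SU3.isOpen_domain, SU3.differentiableOn_modularSum,
    fun τ w γ h => ⟨h.smul γ, SU3.modularSum_smul h.1 γ⟩⟩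
  · obtain ⟨γA, hA, hA0⟩ := SU3.exists_isCycle τ Complex.two_pi_I_ne_zero
    obtain ⟨γB, hB, hB0⟩ := SU3.exists_isCycle τ
      (mul_ne_zero Complex.two_pi_I_ne_zero (UpperHalfPlane.ne_zero τ))
    exact ⟨γA, γB, hA, hB, fun t _ => ⟨hA0 t, hB0 t⟩⟩
  · rcases hγ with hγ | hγ
    · exact SU3.IsCycle.exists_isShort hγ h0
    · exact SU3.IsCycle.exists_isShort hγ h0
  · exact SU3.IsCycle.isClosedPath hA (SU3.two_pi_I_mem_lattice τ) hD.1 hAs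
  · exact SU3.IsCycle.isClosedPath hB (SU3.two_pi_I_mul_mem_lattice τ) hD.1 hBs
  · exact SU3.IsCycle.hasSum_periodTerm hA (SU3.two_pi_I_mem_lattice τ) hD hAs
  · exact SU3.IsCycle.hasSum_periodTerm hB (SU3.two_pi_I_mul_mem_lattice τ) hD hBs
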